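/- A \emph{topological dynamical system} is a pair $(X,T)$ with $X$ a compact metric space and $T:X\to X$ a homeomorphism that has a fixed point and only finitely many points of period $n$ for each $n\ge1$. Let $\mathsf F_T(n)$ be the number of $x\in X$ with $T^n(x)=x$, let $\mathsf O_T(n)$ be the number of closed orbits of length (least period) $n$, and let $\zeta_T(z)=\exp\bigl(\sum_{n\ge1}\mathsf F_T(n)z^n/n\bigr)$. If $\imath:X\to X$ is a continuous involution that commutes with $T$, the \emph{halved system} $(\overline X,\overline T)$ is the quotient space $\overline X$ of $X$ by the equivalence relation with classes $\{x,\imath(x)\}$, with the map $\overline T$ induced by $T$. A circle $|z|=R$ is a \emph{natural boundary} of a function $f$ holomorphic on $|z|<R$ if $f$ has no analytic continuation to a neighbourhood of any point of the circle. There is a unique sequence $(c_n)_{n\ge1}$ of non-negative integers such that $c_n=0$ if $n=1$ or $n$ is prime and, if $n$ is composite, $n\le c_n<2n$ and $c_n\equiv c_{n/p}\pmod{p^{\operatorname{ord}_p(n)}}$ for every prime $p\mid n$. For this sequence, the numbers \[ a_n=\frac1n\sum_{d\mid n}\mu\Bigl(\frac nd\Bigr)2^d,\qquad b_n=a_n+\frac1n\sum_{d\mid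 n}\mu\Bigl(\frac nd\Bigr)c_d2^d\qquad(n\ge1) \] are non-negative integers, and there are a topological dynamical system $(X,T)$ and a continuous involution $\imath$ of $X$ commuting with $T$ such that the halved system $(\overline X,\overline T)$ is again a topological dynamical system, $\mathsf O_T(n)=a_n$ and $\mathsf O_{\overline T}(n)=b_n$ for all $n\ge1$, and the following hold. 1. For $|z|<\frac12$ the series defining $\zeta_T(z)$ converges and $\zeta_T(z)=\dfrac1{1-2z}$; in particular $\zeta_T$ is rational. 2. For $|z|<\frac12$ the series defining $\zeta_{\overline T}(z)$ converges, and \[ z\,\frac{\zeta_{\overline T}'(z)}{\zeta_{\overline T}(z)}=\frac{2z}{1-2z}+\sum_{n\ge1}c_n2^nz^n , \] where the series on the right converges. 3. The power series of $\zeta_{\overline T}$ at $0$ has radius of convergence exactly $\frac12$, and the circle $|z|=\frac12$ is a natural boundary of $\zeta_{\overline T}$. Thus the circle of convergence and the natural boundary of $\zeta_{\overline T}$ coincide. -/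

import Mathlib

/-- A topological dynamical system: `X` is a compact metrizable space and `T` is a homeomorphism of
`X` with a fixed point and with only finitely many points of period `n` for each `n ≥ 1`. -/
structure IsTopDynSystem {X : Type*} [TopologicalSpace X] (T : X ≃ₜ X) : Prop where
  compact : CompactSpace X
  metrizable : TopologicalSpace.MetrizableSpace X
  fixedPoint : ∃ x, T x = x
  finite_period : ∀ n : ℕ, 1 ≤ n → {x : X | T^[n] x = x}.Finite

/-- The number of points `x` with `T^n x = x`. -/
noncomputable def periodCount {X : Type*} (T : X → X) (n : ℕ) : ℕ :=
  {x : X | T^[n] x = x}.ncard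

/-- The closed orbits of length `n ≥ 1`: the sets `{x, T x, …, T^(n-1) x}` where `x` has least
period `n`. -/
def closedOrbits {X : Type*} (T : X → X) (n : ℕ) : Set (Set X) :=
  {τ | ∃ x : X, Function.minimalPeriod T x = n ∧ τ = (fun k : ℕ => T^[k] x) '' Set.Iio n}

/-- The number of closed orbits of length `n`. -/
noncomputable def orbitCount {X : Type*} (T : X → X) (n : ℕ) : ℕ :=
  (closedOrbits T n).ncard

/-- The dynamical zeta function `exp (∑_{n ≥ 1} F_T(n) z^n / n)`. The term with index `0` of the
series below is `0` because of the division by `0`. The value is meaningful where the series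
converges. -/
noncomputable def dynZeta {X : Type*} (T : X → X) (z : ℂ) : ℂ :=
  Complex.exp (∑' n : ℕ, (periodCount T n : ℂ) * z ^ n / (n : ℂ))

/-- A homeomorphism together with a continuous involution commuting with it. -/
structure HalvingData (X : Type*) [TopologicalSpace X] where
  T : X ≃ₜ X
  inv : X → X
  inv_continuous : Continuous inv
  inv_involutive : Function.Involutive inv
  inv_comm : ∀ x, inv (T x) = T (inv x)

namespace HalvingData

variable {X : Type*} [TopologicalSpace X]

/-- The equivalence relation whose classes are the sets `{x, inv x}`. -/
def setoid (H : HalvingData X) : Setoid X where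
  r x y := x = y ∨ x = H.inv y
  iseqv :=
    { refl := fun _ => Or.inl rfl
      symm := by
        rintro x y (h | h)
        · exact Or.inl h.symm
        · exact Or.inr (by rw [h, H.inv_involutive])
      trans := by
        rintro x y z (rfl | rfl) (rfl | rfl)
        · exact Or.inl rfl
        · exact Or.inr rfl
        · exact Or.inr rfl
        · exact Or.inl (H.inv_involutive _) }

/-- The halved space, which carries the quotient topology. -/
abbrev Halved (H : HalvingData X) : Type _ := Quotient H.setoid

theorem symm_comm (H : HalvingData X) (x : X) : H.inv (H.T.symm x) = H.T.symm (H.inv x) := by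
  apply H.T.injective
  rw [← H.inv_comm, H.T.apply_symm_apply, H.T.apply_symm_apply]

/-- The homeomorphism of the halved space induced by `T`, that is `[x] ↦ [T x]`. -/
def halvedMap (H : HalvingData X) : H.Halved ≃ₜ H.Halved where
  toFun := Quotient.map H.T (by
    rintro x y (h | h)
    · exact Or.inl (congrArg H.T h)
    · exact Or.inr (by rw [h, H.inv_comm]))
  invFun := Quotient.map H.T.symm (by
    rintro x y (h | h)
    · exact Or.inl (congrArg H.T.symm h)
    · exact Or.inr (by rw [h, H.symm_comm]))
  left_inv := by
    rintro ⟨x⟩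
    exact congrArg (Quotient.mk H.setoid) (H.T.symm_apply_apply x)
  right_inv := by
    rintro ⟨x⟩
    exact congrArg (Quotient.mk H.setoid) (H.T.apply_symm_apply x)
  continuous_toFun := Continuous.quotient_map' H.T.continuous _
  continuous_invFun := Continuous.quotient_map' H.T.symm.continuous _

theorem halvedMap_mk (H : HalvingData X) (x : X) :
    H.halvedMap (Quotient.mk H.setoid x) = Quotient.mk H.setoid (H.T x) := rfl

end HalvingData

/-- The circle `|z| = R` is a natural boundary of `f`: `f` is holomorphic in the open disc
`|z| < R`, and at no point `w` of the circle does `f` continue analytically across `w`. -/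
def HasNaturalBoundary (f : ℂ → ℂ) (R : ℝ) : Prop :=
  0 < R ∧ DifferentiableOn ℂ f (Metric.ball 0 R) ∧
    ∀ w ∈ Metric.sphere (0 : ℂ) R, ¬ ∃ U : Set ℂ, IsOpen U ∧ w ∈ U ∧ ∃ g : ℂ → ℂ,
      DifferentiableOn ℂ g U ∧ Set.EqOn g f (U ∩ Metric.ball 0 R)

/-- The recursive conditions on the auxiliary sequence `c 1, c 2, …`. The value `c 0` plays no role
and is normalized to `0`. -/
structure IsAuxSeq (c : ℕ → ℕ) : Prop where
  zero : c 0 = 0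
  one : c 1 = 0
  prime : ∀ p : ℕ, p.Prime → c p = 0
  congr : ∀ n : ℕ, 2 ≤ n → ¬ n.Prime → ∀ p : ℕ, p.Prime → p ∣ n →
    c n ≡ c (n / p) [MOD p ^ n.factorization p]
  bounds : ∀ n : ℕ, 2 ≤ n → ¬ n.Prime → n ≤ c n ∧ c n < 2 * n

/-!
**Idea of the proof.**

*Arithmetic.* By the Chinese remainder theorem the congruences fix `c n` modulo `n`, so `c` exists
and is unique. They are the Gauss congruences for `c`; together with those for `2 ^ n` they make `n`
divide the Möbius transforms of `2 ^ n` and `c n * 2 ^ n` (`dvd_moebiusTransform`). The leading term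
of a Möbius transform dominates the rest, which gives `0 ≤ a n ≤ b n`, and `b n ≤ a (2 * n)` for
`n ≥ 2` (`IsAuxSeq.two_mul_moebiusTransform_add_le`).

*Dynamics.* The space is the one-point compactification of a discrete union of cycles, on which `T`
advances every cycle by one step. The involution fixes some cycles pointwise and rotates others, of
even length, by half a turn; in the quotient a cycle of the second kind has half its length
(`CycleUnion.orbitCount_halvedMap`). If `e n` cycles of length `n` are rotated, the halved system
has `a n - e n + e (2 * n)` closed orbits of length `n`. So `e` has to satisfy
`e (2 * n) = b n - a n + e n`, and the inequality `b n ≤ a (2 * n)` is what makes `e n ≤ a n`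
inductively.

*Zeta functions.* It follows that `T` has `2 ^ n` and the halved map `2 ^ n + c n * 2 ^ n` points
fixed by the `n`-th iterate, which gives the first two formulas by summing the series and
differentiating it term by term.

*Natural boundary.* A continuation of the zeta function of the halved system across a point of
`|z| = 1 / 2` yields, through the logarithmic derivative, a continuation of `f = ∑ c n z ^ n` across
a point of the unit circle (`hasNaturalBoundary_of_logDeriv`). By the Pólya–Carlson theorem, of
which a case is proved here (`exists_polynomial_mul_eventually_zero`), `f` would then be rational.
The proof replaces Hankel determinants by Siegel's lemma: there is a nonzero integer polynomial `B`
with small coefficients such that many consecutive coefficients of `B * f` vanish. The contour in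
Cauchy's formula may be pushed outwards along the regular arc, and there is a polynomial `q` with
`q(0) = 1` such that `|q(z)| < |z| ^ N` on the new contour, where `N` bounds the degree of `q`. Hence
the next coefficient of `B * f`, which is also a coefficient of `B * q ^ i * f`, is less than `1` in
absolute value, and is zero. Rationality makes `c` eventually periodic modulo some prime `ℓ`
(`exists_prime_eventually_periodic`), in contradiction to `c p = 0` and `c (p ^ 2) = p ^ 2` for large
primes `p` that are `1` modulo `ℓ` and modulo the period (`IsAuxSeq.not_continuation`).
-/

/-! ### The auxiliary sequence -/

/-- The congruences imposed on `c n` by its values at the divisors `n / p` have exactly one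
solution in `[n, 2n)`: by the Chinese remainder theorem they determine a residue class mod `n`. -/
theorem existsUnique_modEq_of_factorization (n : ℕ) (hn : n ≠ 0) (f : ℕ → ℕ) :
    ∃! x : ℕ, (n ≤ x ∧ x < 2 * n) ∧
      ∀ p : ℕ, p.Prime → p ∣ n → x ≡ f p [MOD p ^ n.factorization p] := by
  have hpp : Set.Pairwise (n.primeFactors : Set ℕ)
      (Function.onFun Nat.Coprime fun p => p ^ n.factorization p) := by
    intro p hp q hq hpq
    exact Nat.Coprime.pow _ _ ((Nat.coprime_primes (Nat.prime_of_mem_primeFactors hp)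
      (Nat.prime_of_mem_primeFactors hq)).2 hpq)
  have hs : ∀ p ∈ n.primeFactors, p ^ n.factorization p ≠ 0 := fun p hp =>
    pow_ne_zero _ (Nat.prime_of_mem_primeFactors hp).ne_zero
  obtain ⟨k, hk⟩ := Nat.chineseRemainderOfFinset f (fun p => p ^ n.factorization p)
    n.primeFactors hs hpp
  refine ⟨n + k % n, ⟨⟨by omega, ?_⟩, ?_⟩, ?_⟩
  · have := Nat.mod_lt k (Nat.pos_of_ne_zero hn)
    omega
  · intro p hp hpn
    refine Nat.ModEq.trans ?_ (hk p (Nat.mem_primeFactors.2 ⟨hp, hpn, hn⟩))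
    refine Nat.ModEq.of_dvd (Nat.ordProj_dvd n p) ?_
    simp [Nat.ModEq]
  · rintro y ⟨⟨hy1, hy2⟩, hy⟩
    have hmod : y ≡ k [MOD n] := by
      have h1 : ((∏ p ∈ n.primeFactors, p ^ n.factorization p : ℕ) : ℤ) ∣ (k : ℤ) - y := by
        push_cast
        refine Finset.prod_dvd_of_coprime ?_ ?_
        · intro p hp q hq hpq
          have := hpp hp hq hpq
          simp only [Function.onFun]
          exact_mod_cast Nat.isCoprime_iff_coprime.2 this
        · intro p hp
          have h1 := hy p (Nat.prime_of_mem_primeFactors hp) (Nat.dvd_of_mem_primeFactors hp)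
          have h2 := (Nat.modEq_iff_dvd).1 (h1.trans (hk p hp).symm)
          exact_mod_cast h2
      rw [show (∏ p ∈ n.primeFactors, p ^ n.factorization p : ℕ) = n from
        Nat.prod_factorization_pow_eq_self hn] at h1
      exact Nat.modEq_iff_dvd.2 h1
    have h3 : (y - n) % n = k % n := by
      have : y - n + n ≡ k [MOD n] := by rwa [Nat.sub_add_cancel hy1]
      simpa [Nat.ModEq] using this
    rw [Nat.mod_eq_of_lt (by omega)] at h3
    omega

/-- The sequence `c` of the recursive conditions, by well-founded recursion. -/
noncomputable def auxSeq (n : ℕ) : ℕ :=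
  if h : 2 ≤ n ∧ ¬ n.Prime then
    (existsUnique_modEq_of_factorization n (by omega)
      (fun p => if hp : p.Prime ∧ p ∣ n then auxSeq (n / p) else 0)).choose
  else 0
termination_by n
decreasing_by all_goals exact Nat.div_lt_self (by omega) hp.1.one_lt

theorem isAuxSeq_auxSeq : IsAuxSeq auxSeq where
  zero := by rw [auxSeq]; simp
  one := by rw [auxSeq]; simp
  prime p hp := by rw [auxSeq]; simp [hp]
  congr n h2 hn p hp hpn := by
    rw [auxSeq, dif_pos ⟨h2, hn⟩]
    have := (existsUnique_modEq_of_factorization n (by omega)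
      (fun p => if hp : p.Prime ∧ p ∣ n then auxSeq (n / p) else 0)).choose_spec.1.2 p hp hpn
    rwa [dif_pos ⟨hp, hpn⟩] at this
  bounds n h2 hn := by
    rw [auxSeq, dif_pos ⟨h2, hn⟩]
    exact (existsUnique_modEq_of_factorization n (by omega)
      (fun p => if hp : p.Prime ∧ p ∣ n then auxSeq (n / p) else 0)).choose_spec.1.1

theorem existsUnique_isAuxSeq : ∃! c : ℕ → ℕ, IsAuxSeq c := by
  refine ⟨auxSeq, isAuxSeq_auxSeq, fun c hc => funext fun n => ?_⟩
  have hd := isAuxSeq_auxSeq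
  induction n using Nat.strong_induction_on with
  | _ n ih =>
    by_cases h2 : 2 ≤ n
    · by_cases hp : n.Prime
      · rw [hc.prime n hp, hd.prime n hp]
      · refine (existsUnique_modEq_of_factorization n (by omega) fun p => c (n / p)).unique
          ⟨hc.bounds n h2 hp, hc.congr n h2 hp⟩ ⟨hd.bounds n h2 hp, fun p hpp hpn => ?_⟩
        rw [ih _ (Nat.div_lt_self (by omega) hpp.one_lt)]
        exact hd.congr n h2 hp p hpp hpn
    · interval_cases n
      · rw [hc.zero, hd.zero]
      · rw [hc.one, hd.one]

namespace IsAuxSeq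

variable {c : ℕ → ℕ}

theorem le_two_mul (hc : IsAuxSeq c) (n : ℕ) : c n ≤ 2 * n := by
  by_cases h2 : 2 ≤ n
  · by_cases hp : n.Prime
    · rw [hc.prime n hp]; omega
    · exact (hc.bounds n h2 hp).2.le
  · interval_cases n
    · rw [hc.zero]
    · rw [hc.one]; omega

theorem modEq_div (hc : IsAuxSeq c) {n p : ℕ} (hn : n ≠ 0) (hp : p.Prime) (hpn : p ∣ n) :
    c n ≡ c (n / p) [MOD p ^ n.factorization p] := by
  by_cases h : n.Prime
  · obtain rfl : p = n := (Nat.prime_dvd_prime_iff_eq hp h).1 hpn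
    rw [Nat.div_self hp.pos, hc.one, hc.prime p hp]
  · exact hc.congr n (hp.two_le.trans (Nat.le_of_dvd (by omega) hpn)) h p hp hpn

theorem prime_sq (hc : IsAuxSeq c) {p : ℕ} (hp : p.Prime) : c (p ^ 2) = p ^ 2 := by
  have h4 : 2 ^ 2 ≤ p ^ 2 := Nat.pow_le_pow_left hp.two_le 2
  have hn : ¬ (p ^ 2).Prime := Nat.Prime.not_prime_pow le_rfl
  have h1 := hc.congr (p ^ 2) (by omega) hn p hp (dvd_pow_self p two_ne_zero)
  have h2 := hc.bounds (p ^ 2) (by omega) hn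
  rw [hp.factorization_pow, Finsupp.single_eq_same, show p ^ 2 / p = p by
    rw [pow_two, Nat.mul_div_cancel _ hp.pos], hc.prime p hp, Nat.modEq_zero_iff_dvd] at h1
  obtain ⟨k, hk⟩ := h1
  have hpos : 0 < p ^ 2 := by omega
  have hk2 : k < 2 := by
    by_contra hcon
    have := Nat.mul_le_mul_left (p ^ 2) (not_lt.1 hcon)
    omega
  interval_cases k <;> omega

end IsAuxSeq

/-! ### Möbius transforms and the numbers of orbits -/

/-- The Möbius transform `n ↦ ∑_{d ∣ n} μ(n / d) u d`. When `u n` counts the points fixed by the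
`n`-th iterate of a map, this is the number of points of least period `n`. -/
def moebiusTransform (u : ℕ → ℤ) (n : ℕ) : ℤ :=
  ∑ d ∈ n.divisors, ArithmeticFunction.moebius (n / d) * u d

theorem sum_divisors_moebiusTransform (u : ℕ → ℤ) {n : ℕ} (hn : 0 < n) :
    ∑ d ∈ n.divisors, moebiusTransform u d = u n := by
  refine (ArithmeticFunction.sum_eq_iff_sum_mul_moebius_eq
    (f := moebiusTransform u) (g := u)).2 (fun m _ => ?_) n hn
  simp only [Int.cast_id]
  rw [Nat.sum_divisorsAntidiagonal' (fun x y => ArithmeticFunction.moebius x * u y)]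
  rfl

/-- Gauss congruences at all primes make `n` divide the Möbius transform at `n`. For each prime `p`,
`u n - u (n / p)` is the sum of the transform over those divisors of `n` that have the same power of
`p` as `n`, so the divisibility by that power follows by strong induction. -/
theorem dvd_moebiusTransform {u : ℕ → ℤ}
    (hu : ∀ n p : ℕ, n ≠ 0 → p.Prime → p ∣ n →
      u n ≡ u (n / p) [ZMOD (p : ℤ) ^ n.factorization p]) {n : ℕ} (hn : n ≠ 0) :
    (n : ℤ) ∣ moebiusTransform u n := by
  have key : ∀ p : ℕ, p.Prime → ∀ n : ℕ, n ≠ 0 →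
      (p : ℤ) ^ n.factorization p ∣ moebiusTransform u n := by
    intro p hp n
    induction n using Nat.strong_induction_on with
    | _ n ih =>
      intro hn
      by_cases hpn : p ∣ n
      swap
      · simp [Nat.factorization_eq_zero_of_not_dvd hpn]
      have hnp : n / p ≠ 0 := (Nat.div_pos (Nat.le_of_dvd (by omega) hpn) hp.pos).ne'
      have hsub : (n / p).divisors ⊆ n.divisors :=
        Nat.divisors_subset_of_dvd hn (Nat.div_dvd_of_dvd hpn)
      have h1 := sum_divisors_moebiusTransform u (Nat.pos_of_ne_zero hn)
      have h2 := sum_divisors_moebiusTransform u (Nat.pos_of_ne_zero hnp)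
      have h3 := Finset.sum_sdiff (f := moebiusTransform u) hsub
      have hmem : n ∈ n.divisors \ (n / p).divisors := by
        simp only [Finset.mem_sdiff, Nat.mem_divisors]
        refine ⟨⟨dvd_rfl, hn⟩, fun h => ?_⟩
        have := Nat.le_of_dvd (Nat.pos_of_ne_zero hnp) h.1
        have := Nat.div_lt_self (Nat.pos_of_ne_zero hn) hp.one_lt
        omega
      rw [← Finset.add_sum_erase _ _ hmem] at h3
      have h4 : (p : ℤ) ^ n.factorization p ∣
          ∑ d ∈ (n.divisors \ (n / p).divisors).erase n, moebiusTransform u d := by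
        refine Finset.dvd_sum fun d hd => ?_
        simp only [Finset.mem_erase, Finset.mem_sdiff, Nat.mem_divisors, not_and, not_not] at hd
        obtain ⟨hdn, ⟨hd1, -⟩, hd2⟩ := hd
        have hd0 : d ≠ 0 := by rintro rfl; exact hn (zero_dvd_iff.1 hd1)
        have hfac : n.factorization p = d.factorization p := by
          refine le_antisymm ?_ ((Nat.factorization_le_iff_dvd hd0 hn).2 hd1 p)
          by_contra hlt
          refine hnp (hd2 ?_)
          rw [← Nat.factorization_le_iff_dvd hd0 hnp, Nat.factorization_div hpn,
            hp.factorization]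
          intro q
          by_cases hq : q = p
          · subst hq
            simp only [Finsupp.coe_tsub, Pi.sub_apply, Finsupp.single_eq_same]
            omega
          · simpa [Finsupp.single_eq_of_ne hq] using
              (Nat.factorization_le_iff_dvd hd0 hn).2 hd1 q
        rw [hfac]
        exact ih d (lt_of_le_of_ne (Nat.le_of_dvd (by omega) hd1) hdn) hd0
      have h5 := (hu n p hn hp hpn).symm.dvd
      have h6 : moebiusTransform u n = (u n - u (n / p)) -
          ∑ d ∈ (n.divisors \ (n / p).divisors).erase n, moebiusTransform u d := by
        linarith
      rw [h6]
      exact dvd_sub h5 h4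
  rw [Int.natCast_dvd, Nat.dvd_iff_prime_pow_dvd_dvd]
  intro p k hp hk
  have h1 := Int.natAbs_dvd_natAbs.2 (key p hp n hn)
  rw [Int.natAbs_pow, Int.natAbs_natCast] at h1
  exact (pow_dvd_pow p ((hp.pow_dvd_iff_le_factorization hn).1 hk)).trans h1

theorem abs_moebiusTransform_sub_le (u : ℕ → ℤ) {n : ℕ} (hn : n ≠ 0) :
    |moebiusTransform u n - u n| ≤ ∑ d ∈ Finset.Icc 1 (n / 2), |u d| := by
  have h1 : moebiusTransform u n - u n =
      ∑ d ∈ n.properDivisors, ArithmeticFunction.moebius (n / d) * u d := by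
    rw [moebiusTransform, ← Nat.cons_self_properDivisors hn, Finset.sum_cons,
      Nat.div_self (Nat.pos_of_ne_zero hn)]
    simp
  rw [h1]
  refine (Finset.abs_sum_le_sum_abs _ _).trans ?_
  calc ∑ d ∈ n.properDivisors, |ArithmeticFunction.moebius (n / d) * u d|
      ≤ ∑ d ∈ n.properDivisors, |u d| := by
        refine Finset.sum_le_sum fun d _ => ?_
        rw [abs_mul]
        exact mul_le_of_le_one_left (abs_nonneg _) ArithmeticFunction.abs_moebius_le_one
    _ ≤ _ := by
        refine Finset.sum_le_sum_of_subset_of_nonneg ?_ fun _ _ _ => abs_nonneg _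
        intro d hd
        rw [Nat.mem_properDivisors] at hd
        obtain ⟨⟨k, rfl⟩, hlt⟩ := hd
        have hd0 : d ≠ 0 := by rintro rfl; simp at hn
        have hk : 2 ≤ k := by
          by_contra hcon
          interval_cases k <;> omega
        rw [Finset.mem_Icc, Nat.le_div_iff_mul_le two_pos]
        exact ⟨Nat.pos_of_ne_zero hd0, Nat.mul_le_mul_left d hk⟩

theorem sum_Icc_two_pow (k : ℕ) : ∑ d ∈ Finset.Icc 1 k, (2 : ℤ) ^ d = 2 ^ (k + 1) - 2 := by
  induction k with
  | zero => simp
  | succ k ih => rw [Finset.sum_Icc_succ_top (by omega), ih]; ring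

theorem two_pow_modEq_two_pow_div {n p : ℕ} (hp : p.Prime) (hn : n ≠ 0) (hpn : p ∣ n) :
    (2 : ℤ) ^ n ≡ 2 ^ (n / p) [ZMOD (p : ℤ) ^ n.factorization p] := by
  obtain ⟨k, hk⟩ : ∃ k, n.factorization p = k + 1 :=
    Nat.exists_eq_succ_of_ne_zero (hp.factorization_pos_of_dvd hn hpn).ne'
  obtain ⟨m, hm⟩ := Nat.ordProj_dvd n p
  rw [hk] at hm
  have hbase : (p : ℤ) ∣ (2 ^ m) ^ p - 2 ^ m := by
    have := Fact.mk hp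
    rw [← ZMod.intCast_zmod_eq_zero_iff_dvd]
    push_cast
    rw [ZMod.pow_card, sub_self]
  have h := dvd_sub_pow_of_dvd_sub (R := ℤ) hbase k
  have hdiv : n / p = m * p ^ k := by
    rw [hm, pow_succ]
    rw [show p ^ k * p * m = p * (m * p ^ k) by ring, Nat.mul_div_cancel_left _ hp.pos]
  rw [hk, hdiv, hm, pow_succ p k, show p ^ k * p * m = m * p * p ^ k by ring, pow_mul 2 (m * p),
    pow_mul 2 m, pow_mul 2 m]
  exact (Int.modEq_iff_dvd.2 h).symm

theorem moebiusTransform_two_pow_bounds {n : ℕ} (hn : n ≠ 0) :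
    0 ≤ moebiusTransform (fun d => 2 ^ d) n ∧ moebiusTransform (fun d => 2 ^ d) n ≤ 2 ^ n ∧
      2 ^ n - 2 ^ (n / 2 + 1) ≤ moebiusTransform (fun d => 2 ^ d) n := by
  have nonneg : ∀ n : ℕ, n ≠ 0 → 0 ≤ moebiusTransform (fun d => 2 ^ d) n ∧
      2 ^ n - 2 ^ (n / 2 + 1) ≤ moebiusTransform (fun d => 2 ^ d) n := by
    intro n hn
    have h := (abs_le.1 (abs_moebiusTransform_sub_le (fun d => 2 ^ d) hn)).1
    simp only [abs_pow, abs_two] at h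
    rw [sum_Icc_two_pow] at h
    rcases Nat.lt_or_ge n 2 with h2 | h2
    · obtain rfl : n = 1 := by omega
      norm_num at h
      refine ⟨by linarith, ?_⟩
      norm_num
      linarith
    · have : (2 : ℤ) ^ (n / 2 + 1) ≤ 2 ^ n := pow_le_pow_right₀ (by norm_num) (by omega)
      exact ⟨by linarith, by linarith⟩
  refine ⟨(nonneg n hn).1, ?_, (nonneg n hn).2⟩
  have h := sum_divisors_moebiusTransform (fun d => 2 ^ d) (Nat.pos_of_ne_zero hn)
  rw [← h]
  exact Finset.single_le_sum (f := moebiusTransform (fun d => 2 ^ d))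
    (fun d hd => (nonneg d (Nat.pos_of_mem_divisors hd).ne').1) (Nat.mem_divisors_self n hn)

namespace IsAuxSeq

variable {c : ℕ → ℕ}

theorem mul_two_pow_modEq (hc : IsAuxSeq c) (n p : ℕ) (hn : n ≠ 0) (hp : p.Prime) (hpn : p ∣ n) :
    (c n : ℤ) * 2 ^ n ≡ c (n / p) * 2 ^ (n / p) [ZMOD (p : ℤ) ^ n.factorization p] := by
  refine Int.ModEq.mul ?_ (two_pow_modEq_two_pow_div hp hn hpn)
  have := hc.modEq_div hn hp hpn
  exact_mod_cast Int.natCast_modEq_iff.2 this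

theorem abs_moebiusTransform_sub_le (hc : IsAuxSeq c) {n : ℕ} (hn : n ≠ 0) :
    |moebiusTransform (fun d => c d * 2 ^ d) n - c n * 2 ^ n| ≤ n * 2 ^ (n / 2 + 1) := by
  refine (_root_.abs_moebiusTransform_sub_le _ hn).trans ?_
  calc ∑ d ∈ Finset.Icc 1 (n / 2), |(c d : ℤ) * 2 ^ d|
      ≤ ∑ d ∈ Finset.Icc 1 (n / 2), (n : ℤ) * 2 ^ d := by
        refine Finset.sum_le_sum fun d hd => ?_
        rw [abs_of_nonneg (by positivity)]
        have h1 := hc.le_two_mul d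
        have h2 : d ≤ n / 2 := (Finset.mem_Icc.1 hd).2
        have h3 : (c d : ℤ) ≤ n := by omega
        gcongr
    _ ≤ n * 2 ^ (n / 2 + 1) := by
        rw [← Finset.mul_sum, sum_Icc_two_pow]
        gcongr
        linarith

theorem moebiusTransform_eq_zero (hc : IsAuxSeq c) {n : ℕ} (hn : n = 1 ∨ n.Prime) :
    moebiusTransform (fun d => c d * 2 ^ d) n = 0 := by
  refine Finset.sum_eq_zero fun d hd => ?_
  have hd0 : c d = 0 := by
    rcases hn with rfl | hp
    · obtain rfl : d = 1 := by simpa using hd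
      exact hc.one
    · rcases (Nat.dvd_prime hp).1 (Nat.dvd_of_mem_divisors hd) with rfl | rfl
      · exact hc.one
      · exact hc.prime _ hp
  simp [hd0]

theorem moebiusTransform_nonneg (hc : IsAuxSeq c) {n : ℕ} (hn : n ≠ 0) :
    0 ≤ moebiusTransform (fun d => c d * 2 ^ d) n := by
  by_cases h : n = 1 ∨ n.Prime
  · rw [hc.moebiusTransform_eq_zero h]
  · push Not at h
    have h1 := (abs_le.1 (hc.abs_moebiusTransform_sub_le hn)).1
    have h2 := (hc.bounds n (by omega) h.2).1
    have h3 : (n : ℤ) * 2 ^ (n / 2 + 1) ≤ c n * 2 ^ n := by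
      have : (n : ℤ) ≤ c n := by exact_mod_cast h2
      gcongr
      · norm_num
      · omega
    linarith

theorem four (hc : IsAuxSeq c) : c 4 = 4 := hc.prime_sq Nat.prime_two

/-- The estimate behind `b n ≤ a (2 * n)`: the system has enough closed orbits of length `2 * n`
for the involution to act on `b n - a n` of them by a half turn. -/
theorem two_mul_moebiusTransform_add_le (hc : IsAuxSeq c) {n : ℕ} (hn : 2 ≤ n) :
    2 * (moebiusTransform (fun d => 2 ^ d) n + moebiusTransform (fun d => c d * 2 ^ d) n) ≤
      moebiusTransform (fun d => 2 ^ d) (2 * n) := by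
  have hn0 : n ≠ 0 := by omega
  obtain ⟨-, h1, -⟩ := moebiusTransform_two_pow_bounds hn0
  obtain ⟨-, -, h2⟩ := moebiusTransform_two_pow_bounds (n := 2 * n) (by omega)
  rw [Nat.mul_div_cancel_left _ two_pos] at h2
  have hsq : (2 : ℤ) ^ (2 * n) = 2 ^ n * 2 ^ n := by rw [two_mul, pow_add]
  rw [hsq, pow_succ] at h2
  have h4 : (4 : ℤ) ≤ 2 ^ n := by
    calc (4 : ℤ) = 2 ^ 2 := by norm_num
      _ ≤ 2 ^ n := pow_le_pow_right₀ (by norm_num) hn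
  by_cases h : n.Prime
  · rw [hc.moebiusTransform_eq_zero (Or.inr h)]
    nlinarith
  by_cases hn4 : n = 4
  · subst hn4
    have hd4 : (4 : ℕ).divisors = {1, 2, 4} := by decide
    have hd8 : (2 * 4 : ℕ).divisors = {1, 2, 4, 8} := by decide
    have m2 : ArithmeticFunction.moebius 2 = -1 :=
      ArithmeticFunction.moebius_apply_prime Nat.prime_two
    have m4 : ArithmeticFunction.moebius 4 = 0 :=
      ArithmeticFunction.moebius_eq_zero_of_not_squarefree (by decide)
    have m8 : ArithmeticFunction.moebius 8 = 0 :=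
      ArithmeticFunction.moebius_eq_zero_of_not_squarefree (by decide)
    simp only [moebiusTransform, hd4, hd8]
    simp [m2, m4, m8, hc.one, hc.four, hc.prime 2 Nat.prime_two]
  have h5 : 5 ≤ n := by
    by_contra hcon
    interval_cases n
    · exact h Nat.prime_two
    · exact h Nat.prime_three
    · exact hn4 rfl
  have h6 := (abs_le.1 (hc.abs_moebiusTransform_sub_le hn0)).2
  have h7 := (hc.bounds n hn h).2
  have h8 : (c n : ℤ) * 2 ^ n ≤ (2 * n - 1) * 2 ^ n := by
    have : (c n : ℤ) ≤ 2 * n - 1 := by omega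
    gcongr
  have h9 : 2 * (2 : ℤ) ^ (n / 2 + 1) ≤ 2 ^ n := by
    rw [← pow_succ']
    exact pow_le_pow_right₀ (by norm_num) (by omega)
  have h10 : (5 * n + 2 : ℤ) ≤ 2 ^ n := by
    clear * - h5
    induction n, h5 using Nat.le_induction with
    | base => norm_num
    | succ k hk ih => rw [pow_succ]; push_cast; omega
  have h11 : (n : ℤ) * (2 * 2 ^ (n / 2 + 1)) ≤ n * 2 ^ n := by gcongr
  have h12 : (5 * n + 2 : ℤ) * 2 ^ n ≤ 2 ^ n * 2 ^ n := by gcongr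
  linarith

end IsAuxSeq

/-- The number of closed orbits of length `n` that the involution rotates by half a turn, when the
halved system is to have `δ n` more closed orbits of length `n` than the given one: those of
length `2 * n` have to make up for the ones of length `n` that are lost. -/
def halfTurnCount (δ : ℕ → ℕ) (n : ℕ) : ℕ :=
  if _h : Even n ∧ n ≠ 0 then δ (n / 2) + halfTurnCount δ (n / 2) else 0
termination_by n
decreasing_by exact Nat.div_lt_self (Nat.pos_of_ne_zero _h.2) one_lt_two

theorem halfTurnCount_of_not_even (δ : ℕ → ℕ) {n : ℕ} (hn : ¬ Even n) :
    halfTurnCount δ n = 0 := by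
  rw [halfTurnCount, dif_neg (fun h => hn h.1)]

theorem halfTurnCount_two_mul (δ : ℕ → ℕ) {n : ℕ} (hn : n ≠ 0) :
    halfTurnCount δ (2 * n) = δ n + halfTurnCount δ n := by
  rw [halfTurnCount, dif_pos ⟨even_two_mul n, by omega⟩, Nat.mul_div_cancel_left _ two_pos]

/-- The numbers `a` and `b` of closed orbits, and the numbers `e` of closed orbits of length `n`
that the involution has to rotate by half a turn. -/
theorem IsAuxSeq.exists_orbit_numbers {c : ℕ → ℕ} (hc : IsAuxSeq c) :
    ∃ a b e : ℕ → ℕ,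
      (∀ n, n ≠ 0 → (n * a n : ℤ) = moebiusTransform (fun d => 2 ^ d) n) ∧
      (∀ n, n ≠ 0 → (n * b n : ℤ) = moebiusTransform (fun d => 2 ^ d) n +
        moebiusTransform (fun d => c d * 2 ^ d) n) ∧
      a 1 = 2 ∧ e 1 = 0 ∧ (∀ n, n ≠ 0 → e n ≤ a n) ∧ (∀ n, ¬ Even n → e n = 0) ∧
      ∀ n, n ≠ 0 → b n + e n = a n + e (2 * n) := by
  have hA : ∀ n : ℕ, ∃ k : ℕ, n ≠ 0 → (n * k : ℤ) = moebiusTransform (fun d => 2 ^ d) n := by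
    intro n
    by_cases hn : n = 0
    · exact ⟨0, fun h => absurd hn h⟩
    obtain ⟨k, hk⟩ := dvd_moebiusTransform (u := fun d => 2 ^ d)
      (fun n p hn hp hpn => two_pow_modEq_two_pow_div hp hn hpn) hn
    have hk0 : 0 ≤ k := by
      refine nonneg_of_mul_nonneg_right (a := (n : ℤ)) ?_ (by omega)
      rw [← hk]
      exact (moebiusTransform_two_pow_bounds hn).1
    exact ⟨k.toNat, fun _ => by rw [hk, Int.toNat_of_nonneg hk0]⟩
  have hD : ∀ n : ℕ, ∃ k : ℕ, n ≠ 0 →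
      (n * k : ℤ) = moebiusTransform (fun d => c d * 2 ^ d) n := by
    intro n
    by_cases hn : n = 0
    · exact ⟨0, fun h => absurd hn h⟩
    obtain ⟨k, hk⟩ := dvd_moebiusTransform (u := fun d => c d * 2 ^ d) hc.mul_two_pow_modEq hn
    have hk0 : 0 ≤ k := by
      refine nonneg_of_mul_nonneg_right (a := (n : ℤ)) ?_ (by omega)
      rw [← hk]
      exact hc.moebiusTransform_nonneg hn
    exact ⟨k.toNat, fun _ => by rw [hk, Int.toNat_of_nonneg hk0]⟩
  choose a ha using hA
  choose δ hδ using hD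
  refine ⟨a, fun n => a n + δ n, halfTurnCount δ, ha, fun n hn => ?_, ?_, ?_, ?_,
    fun n hn => halfTurnCount_of_not_even δ hn, fun n hn => ?_⟩
  · rw [← ha n hn, ← hδ n hn]; push_cast; ring
  · have := ha 1 one_ne_zero
    simp [moebiusTransform] at this
    omega
  · exact halfTurnCount_of_not_even δ (by decide)
  · intro n
    induction n using Nat.strong_induction_on with
    | _ n ih =>
      intro hn
      by_cases he : Even n
      swap
      · rw [halfTurnCount_of_not_even δ he]; exact Nat.zero_le _
      obtain ⟨m, rfl⟩ := he.two_dvd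
      have hm : m ≠ 0 := by omega
      rw [halfTurnCount_two_mul δ hm]
      by_cases hm1 : m = 1
      · subst hm1
        have h1 := hδ 1 one_ne_zero
        rw [hc.moebiusTransform_eq_zero (Or.inl rfl)] at h1
        rw [halfTurnCount_of_not_even δ (by decide)]
        omega
      have h1 := hc.two_mul_moebiusTransform_add_le (n := m) (by omega)
      rw [← ha m hm, ← hδ m hm, ← ha (2 * m) hn] at h1
      have h2 : a m + δ m ≤ a (2 * m) := by
        have h3 : (2 * m : ℤ) * (a m + δ m : ℕ) ≤ 2 * m * a (2 * m) := by
          push_cast at h1 ⊢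
          linarith
        exact_mod_cast le_of_mul_le_mul_left h3 (by omega)
      have := ih m (by omega) hm
      omega
  · simp only [halfTurnCount_two_mul δ hn]
    omega

/-! ### Counting periodic points by closed orbits -/

section Counting

variable {X : Type*} {T : X → X}

theorem ncard_image_iterate_Iio {x : X} {n : ℕ} (hx : Function.minimalPeriod T x = n) :
    ((fun k : ℕ => T^[k] x) '' Set.Iio n).ncard = n := by
  subst hx
  rw [Function.iterate_injOn_Iio_minimalPeriod.ncard_image, ← Finset.coe_Iio,
    Set.ncard_coe_finset, Nat.card_Iio]

/-- The points of least period `n` with the same orbit as `x` are the points of that orbit. -/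
theorem image_iterate_Iio_eq_iff {x y : X} {n : ℕ} (hn : 0 < n)
    (hx : Function.minimalPeriod T x = n) :
    (Function.minimalPeriod T y = n ∧
      (fun k : ℕ => T^[k] y) '' Set.Iio n = (fun k : ℕ => T^[k] x) '' Set.Iio n) ↔
    y ∈ (fun k : ℕ => T^[k] x) '' Set.Iio n := by
  constructor
  · rintro ⟨-, h⟩
    rw [← h]
    exact ⟨0, hn, rfl⟩
  · rintro ⟨k, hk, rfl⟩
    have hper : x ∈ Function.periodicPts T :=
      Function.minimalPeriod_pos_iff_mem_periodicPts.1 (hx ▸ hn)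
    have hy : Function.minimalPeriod T (T^[k] x) = n := by
      rw [Function.minimalPeriod_apply_iterate hper, hx]
    refine ⟨hy, Set.eq_of_subset_of_ncard_le ?_ ?_ ((Set.finite_Iio n).image _)⟩
    · rintro _ ⟨j, -, rfl⟩
      refine ⟨(j + k) % n, Nat.mod_lt _ hn, ?_⟩
      simp only
      rw [← hx, Function.iterate_mod_minimalPeriod_eq, Function.iterate_add_apply]
    · rw [ncard_image_iterate_Iio hx, ncard_image_iterate_Iio hy]

theorem ncard_minimalPeriod_eq {n : ℕ} (hn : 0 < n)
    (hfin : {x : X | Function.minimalPeriod T x = n}.Finite) :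
    {x : X | Function.minimalPeriod T x = n}.ncard = n * orbitCount T n := by
  classical
  set orb : X → Set X := fun x => (fun k : ℕ => T^[k] x) '' Set.Iio n
  have hset : closedOrbits T n = orb '' {x : X | Function.minimalPeriod T x = n} := by
    ext τ
    simp only [closedOrbits, Set.mem_ofPred_eq, Set.mem_image]
    exact exists_congr fun x => and_congr_right fun _ => eq_comm
  obtain ⟨P, hP⟩ : ∃ P : Finset X, (P : Set X) = {x : X | Function.minimalPeriod T x = n} :=
    ⟨hfin.toFinset, hfin.coe_toFinset⟩
  rw [orbitCount, hset, ← hP, ← Finset.coe_image, Set.ncard_coe_finset, Set.ncard_coe_finset,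
    mul_comm]
  rw [Finset.card_eq_sum_card_image orb P]
  refine Finset.sum_const_nat fun τ hτ => ?_
  obtain ⟨x, hx, rfl⟩ := Finset.mem_image.1 hτ
  have hmem : ∀ y, y ∈ P ↔ Function.minimalPeriod T y = n := fun y => by
    rw [← Finset.mem_coe, hP]
    rfl
  have hset : (({y ∈ P | orb y = orb x} : Finset X) : Set X) = orb x := by
    ext y
    rw [Finset.mem_coe, Finset.mem_filter, hmem]
    exact image_iterate_Iio_eq_iff hn ((hmem x).1 hx)
  rw [← Set.ncard_coe_finset, hset]
  exact ncard_image_iterate_Iio ((hmem x).1 hx)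

theorem periodCount_eq_sum_divisors
    (hfin : ∀ n : ℕ, 1 ≤ n → {x : X | T^[n] x = x}.Finite) {n : ℕ} (hn : 1 ≤ n) :
    periodCount T n = ∑ d ∈ n.divisors, d * orbitCount T d := by
  classical
  obtain ⟨P, hP⟩ : ∃ P : Finset X, (P : Set X) = {x : X | T^[n] x = x} :=
    ⟨(hfin n hn).toFinset, (hfin n hn).coe_toFinset⟩
  have hmem : ∀ x, x ∈ P ↔ Function.minimalPeriod T x ∣ n := fun x => by
    rw [← Finset.mem_coe, hP, ← Function.isPeriodicPt_iff_minimalPeriod_dvd]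
    rfl
  rw [periodCount, ← hP, Set.ncard_coe_finset, Finset.card_eq_sum_card_fiberwise
    (f := Function.minimalPeriod T) (t := n.divisors)
    (fun x hx => by
      rw [Finset.mem_coe, Nat.mem_divisors]
      exact ⟨(hmem x).1 hx, by omega⟩)]
  refine Finset.sum_congr rfl fun d hd => ?_
  have hd1 : d ∣ n := Nat.dvd_of_mem_divisors hd
  have hset : (({x ∈ P | Function.minimalPeriod T x = d} : Finset X) : Set X) =
      {x : X | Function.minimalPeriod T x = d} := by
    ext x
    simp only [Finset.coe_filter, hmem, Set.mem_ofPred_eq]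
    exact ⟨fun h => h.2, fun h => ⟨h ▸ hd1, h⟩⟩
  rw [← Set.ncard_coe_finset, hset]
  exact ncard_minimalPeriod_eq (Nat.pos_of_mem_divisors hd) (hset ▸ Finset.finite_toSet _)

theorem Function.Semiconj.orbitCount_eq {Y : Type*} {S : Y → Y} {f : X → Y}
    (hf : Function.Bijective f) (h : Function.Semiconj f T S) (n : ℕ) :
    orbitCount T n = orbitCount S n := by
  have hmin : ∀ x, Function.minimalPeriod S (f x) = Function.minimalPeriod T x := fun x => by
    refine Function.minimalPeriod_eq_minimalPeriod_iff.2 fun m => ?_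
    rw [Function.IsPeriodicPt, Function.IsFixedPt, ← (h.iterate_right m).eq, hf.1.eq_iff]
    rfl
  have hset : closedOrbits S n = (fun τ => f '' τ) '' closedOrbits T n := by
    ext τ
    have himg : ∀ x, f '' ((fun k : ℕ => T^[k] x) '' Set.Iio n) =
        (fun k : ℕ => S^[k] (f x)) '' Set.Iio n := fun x => by
      rw [Set.image_image]
      simp only [(h.iterate_right _).eq]
    constructor
    · rintro ⟨y, hy, rfl⟩
      obtain ⟨x, rfl⟩ := hf.2 y
      exact ⟨_, ⟨x, by rw [← hmin, hy], rfl⟩, himg x⟩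
    · rintro ⟨_, ⟨x, hx, rfl⟩, rfl⟩
      exact ⟨f x, by rw [hmin, hx], himg x⟩
  rw [orbitCount, orbitCount, hset, Set.ncard_image_of_injective _ hf.1.image_injective]

end Counting

/-! ### Halved systems -/

namespace HalvingData

variable {X : Type*} [TopologicalSpace X] (H : HalvingData X)

theorem isOpenQuotientMap_mk : IsOpenQuotientMap (Quotient.mk H.setoid) where
  surjective := Quotient.mk_surjective
  continuous := continuous_quotient_mk'
  isOpenMap U hU := by
    have h : Quotient.mk H.setoid ⁻¹' (Quotient.mk H.setoid '' U) = U ∪ H.inv ⁻¹' U := by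
      ext x
      constructor
      · rintro ⟨y, hy, hxy⟩
        rcases Quotient.exact hxy with h | h
        · exact Or.inl (h ▸ hy)
        · refine Or.inr ?_
          rwa [Set.mem_preimage, ← h]
      · rintro (hx | hx)
        · exact ⟨x, hx, rfl⟩
        · exact ⟨_, hx, Quotient.sound (Or.inr rfl)⟩
    exact isOpen_coinduced.2 (h ▸ hU.union (hU.preimage H.inv_continuous))

/-- The quotient map is open and its kernel is closed, so the quotient of a compact metrizable space
is Hausdorff and second countable. -/
theorem metrizableSpace_halved [CompactSpace X] [TopologicalSpace.MetrizableSpace X] :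
    TopologicalSpace.MetrizableSpace H.Halved := by
  have hq := H.isOpenQuotientMap_mk
  have : SecondCountableTopology X := by
    let _ := TopologicalSpace.metrizableSpaceMetric X
    infer_instance
  have : SecondCountableTopology H.Halved :=
    hq.isQuotientMap.secondCountableTopology hq.isOpenMap
  have : T2Space H.Halved := by
    rw [t2Space_iff_of_isOpenQuotientMap hq]
    have : {q : X × X | Quotient.mk H.setoid q.1 = Quotient.mk H.setoid q.2} =
        {q : X × X | q.1 = q.2} ∪ {q : X × X | q.1 = H.inv q.2} := by
      ext q
      exact Quotient.eq (r := H.setoid)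
    rw [this]
    exact (isClosed_eq continuous_fst continuous_snd).union
      (isClosed_eq continuous_fst (H.inv_continuous.comp continuous_snd))
  infer_instance

theorem halvedMap_iterate_mk (n : ℕ) (x : X) :
    H.halvedMap^[n] (Quotient.mk H.setoid x) = Quotient.mk H.setoid (H.T^[n] x) :=
  ((show Function.Semiconj (Quotient.mk H.setoid) H.T H.halvedMap from
    fun x => (H.halvedMap_mk x).symm).iterate_right n x).symm

theorem inv_iterate (n : ℕ) (x : X) : H.inv (H.T^[n] x) = H.T^[n] (H.inv x) :=
  (show Function.Semiconj H.inv H.T H.T from H.inv_comm).iterate_right n x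

theorem isTopDynSystem_halvedMap (h : IsTopDynSystem H.T) : IsTopDynSystem H.halvedMap where
  compact := by
    have := h.compact
    exact Quotient.compactSpace
  metrizable := by
    have := h.compact
    have := h.metrizable
    exact H.metrizableSpace_halved
  fixedPoint := by
    obtain ⟨x, hx⟩ := h.fixedPoint
    exact ⟨Quotient.mk H.setoid x, by rw [H.halvedMap_mk, hx]⟩
  finite_period n hn := by
    -- if `T^n x` is `x` or `inv x`, then `T^(2 n) x = x`
    refine ((h.finite_period (n + n) (by omega)).image (Quotient.mk H.setoid)).subset ?_
    rintro ⟨x⟩ hx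
    refine ⟨x, ?_, rfl⟩
    have hx' : H.halvedMap^[n] (Quotient.mk H.setoid x) = Quotient.mk H.setoid x := hx
    rw [H.halvedMap_iterate_mk] at hx'
    rw [Set.mem_ofPred_eq, Function.iterate_add_apply]
    rcases Quotient.exact hx' with h1 | h1
    · rw [h1, h1]
    · rw [h1, ← H.inv_iterate, h1, H.inv_involutive]

end HalvingData

/-! ### One-point compactifications of unions of cycles -/

/-- The disjoint union of cycles of the lengths `len o`, each of them a copy of `ℤ / len o`. It
carries the discrete topology. -/
def CycleUnion {ω : Type*} (len : ω → ℕ) : Type _ := Σ o, ZMod (len o)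

namespace CycleUnion

open scoped OnePoint

variable {ω : Type*} (len : ω → ℕ)

instance : TopologicalSpace (CycleUnion len) := ⊥

instance : DiscreteTopology (CycleUnion len) := ⟨rfl⟩

/-- Rotate the cycle with index `o` by `r o`. -/
def rotate (r : ω → ℕ) : CycleUnion len ≃ CycleUnion len :=
  Equiv.sigmaCongrRight fun o => Equiv.addRight (r o : ZMod (len o))

/-- The extension of `rotate` to the one-point compactification. It fixes the point at infinity. -/
def rotateHomeo (r : ω → ℕ) : OnePoint (CycleUnion len) ≃ₜ OnePoint (CycleUnion len) :=
  ((rotate len r).toHomeomorphOfDiscrete).onePointCongr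

/-- The point with coordinate `i` on the cycle with index `o`. -/
def point (o : ω) (i : ZMod (len o)) : OnePoint (CycleUnion len) :=
  OnePoint.some (⟨o, i⟩ : CycleUnion len)

variable {len} in
theorem point_cases {motive : OnePoint (CycleUnion len) → Prop} (infty : motive ∞)
    (point : ∀ o i, motive (point len o i)) (x : OnePoint (CycleUnion len)) : motive x := by
  induction x using OnePoint.rec with
  | infty => exact infty
  | coe x => exact point x.1 x.2

theorem point_ne_infty (o : ω) (i : ZMod (len o)) : point len o i ≠ ∞ := OnePoint.coe_ne_infty _

theorem rotateHomeo_infty (r : ω → ℕ) : rotateHomeo len r ∞ = ∞ := rfl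

theorem rotateHomeo_coe (r : ω → ℕ) (o : ω) (i : ZMod (len o)) :
    rotateHomeo len r (point len o i) =
      point len o (i + r o) := rfl

/-- The map that advances each cycle by one step. -/
def step : OnePoint (CycleUnion len) ≃ₜ OnePoint (CycleUnion len) := rotateHomeo len fun _ => 1

theorem step_iterate_infty (k : ℕ) : (step len)^[k] ∞ = ∞ :=
  Function.iterate_fixed (rotateHomeo_infty len _) k

theorem step_iterate_coe (k : ℕ) (o : ω) (i : ZMod (len o)) :
    (step len)^[k] (point len o i) =
      point len o (i + k) := by
  induction k generalizing i with
  | zero => simp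
  | succ k ih =>
    rw [Function.iterate_succ_apply, step, rotateHomeo_coe, ← step, ih]
    push_cast
    rw [add_assoc, add_comm (1 : ZMod (len o))]

theorem minimalPeriod_step_infty : Function.minimalPeriod (step len) ∞ = 1 :=
  Function.minimalPeriod_eq_one_iff_isFixedPt.2 (rotateHomeo_infty len _)

theorem coe_mk_inj {o : ω} {i j : ZMod (len o)} :
    point len o i = point len o j ↔ i = j := by
  refine OnePoint.coe_eq_coe.trans ?_
  exact ⟨fun h => eq_of_heq (Sigma.mk.inj h).2, fun h => h ▸ rfl⟩

theorem minimalPeriod_step_coe (o : ω) (i : ZMod (len o)) :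
    Function.minimalPeriod (step len) (point len o i) =
      len o := by
  have h : ∀ k, Function.minimalPeriod (step len) (point len o i) ∣ k ↔ len o ∣ k := fun k => by
    rw [← Function.isPeriodicPt_iff_minimalPeriod_dvd, Function.IsPeriodicPt, Function.IsFixedPt,
      step_iterate_coe, coe_mk_inj, add_eq_left, ZMod.natCast_eq_zero_iff]
  exact Nat.dvd_antisymm ((h _).2 dvd_rfl) ((h _).1 dvd_rfl)

/-- The cycles of the one-point compactification, with `none` for the point at infinity. -/
def cycle : Option ω → Set (OnePoint (CycleUnion len))
  | none => {∞}
  | some o => Set.range fun i : ZMod (len o) => point len o i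

/-- The length of a cycle. -/
def cycleLength (o : Option ω) : ℕ := o.elim 1 len

theorem cycle_injective : Function.Injective (cycle len) := by
  rintro (_ | o) (_ | o') h
  · rfl
  · have : point len o' 0 ∈ cycle len none :=
      h ▸ ⟨0, rfl⟩
    exact absurd this (OnePoint.coe_ne_infty _)
  · have : point len o 0 ∈ cycle len none :=
      h ▸ ⟨0, rfl⟩
    exact absurd this (OnePoint.coe_ne_infty _)
  · have : point len o 0 ∈ cycle len (some o') :=
      h ▸ ⟨0, rfl⟩
    obtain ⟨i, hi⟩ := this
    rw [(Sigma.mk.inj (OnePoint.coe_eq_coe.1 hi)).1]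

variable {len}

theorem image_step_iterate (hlen : ∀ o, 0 < len o) (o : ω) (i : ZMod (len o)) :
    (fun k : ℕ => (step len)^[k] (point len o i)) ''
      Set.Iio (len o) = cycle len (some o) := by
  have : NeZero (len o) := ⟨(hlen o).ne'⟩
  ext x
  simp only [step_iterate_coe]
  constructor
  · rintro ⟨k, -, rfl⟩
    exact ⟨_, rfl⟩
  · rintro ⟨j, rfl⟩
    refine ⟨(j - i).val, ZMod.val_lt _, ?_⟩
    simp only [coe_mk_inj, ZMod.natCast_val, ZMod.cast_id', id_eq]
    ring

theorem closedOrbits_step (hlen : ∀ o, 0 < len o) (n : ℕ) :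
    closedOrbits (step len) n = cycle len '' {o | cycleLength len o = n} := by
  have hinf : (fun k : ℕ => (step len)^[k] ∞) '' Set.Iio 1 = cycle len none := by
    simp only [step_iterate_infty]
    exact Set.Nonempty.image_const ⟨0, Set.mem_Iio.2 one_pos⟩ _
  ext τ
  constructor
  · rintro ⟨x, hx, rfl⟩
    induction x using point_cases with
    | infty =>
      rw [minimalPeriod_step_infty] at hx
      subst hx
      exact ⟨none, rfl, hinf.symm⟩
    | point o i =>
      rw [minimalPeriod_step_coe] at hx
      subst hx
      exact ⟨some o, rfl, (image_step_iterate hlen o i).symm⟩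
  · rintro ⟨_ | o, ho, rfl⟩
    · obtain rfl : 1 = n := ho
      exact ⟨∞, minimalPeriod_step_infty len, hinf.symm⟩
    · obtain rfl : len o = n := ho
      exact ⟨_, minimalPeriod_step_coe len o 0, (image_step_iterate hlen o 0).symm⟩

theorem orbitCount_step (hlen : ∀ o, 0 < len o) (n : ℕ) :
    orbitCount (step len) n = {o | cycleLength len o = n}.ncard := by
  rw [orbitCount, closedOrbits_step hlen, Set.ncard_image_of_injective _ (cycle_injective len)]

/-- The points of `D` can be sent to distinct numbers `1 / (m + 1)`, and the point at infinity to
their limit `0`. -/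
theorem metrizableSpace_onePoint (D : Type*) [Countable D] [TopologicalSpace D]
    [DiscreteTopology D] : TopologicalSpace.MetrizableSpace (OnePoint D) := by
  obtain ⟨f, hf⟩ := exists_injective_nat D
  set g : OnePoint D → ℝ := fun x => x.elim 0 fun d => 1 / ((f d : ℝ) + 1)
  have hg : Function.Injective g := by
    intro x y hxy
    have hpos : ∀ d : D, (0 : ℝ) < 1 / ((f d : ℝ) + 1) := fun d => by positivity
    induction x using OnePoint.rec with
    | infty =>
      induction y using OnePoint.rec with
      | infty => rfl
      | coe y => exact absurd hxy (hpos y).ne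
    | coe x =>
      induction y using OnePoint.rec with
      | infty => exact absurd hxy (hpos x).ne'
      | coe y =>
        have h1 : 1 / ((f x : ℝ) + 1) = 1 / ((f y : ℝ) + 1) := hxy
        rw [one_div, one_div, inv_inj, add_left_inj, Nat.cast_inj] at h1
        rw [hf h1]
  have hcont : Continuous g := by
    rw [OnePoint.continuous_iff_from_discrete]
    exact tendsto_one_div_add_atTop_nhds_zero_nat.comp
      (Nat.cofinite_eq_atTop ▸ hf.tendsto_cofinite)
  exact (hcont.isClosedEmbedding hg).isEmbedding.metrizableSpace

theorem isTopDynSystem_step [Countable ω] (hlen : ∀ o, 0 < len o)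
    (hfin : ∀ n, {o | len o = n}.Finite) : IsTopDynSystem (step len) where
  compact := inferInstance
  metrizable := by
    have : ∀ o, Countable (ZMod (len o)) := fun o => by
      have : NeZero (len o) := ⟨(hlen o).ne'⟩
      exact Finite.to_countable
    have : Countable (CycleUnion len) := inferInstanceAs (Countable (Σ o, ZMod (len o)))
    exact metrizableSpace_onePoint _
  fixedPoint := ⟨∞, rotateHomeo_infty len _⟩
  finite_period n hn := by
    have h1 : (⋃ d ∈ n.divisors, ⋃ o ∈ {o | len o = d}, cycle len (some o)).Finite := by
      refine Set.Finite.biUnion (Finset.finite_toSet _) fun d _ => (hfin d).biUnion fun o _ => ?_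
      have : NeZero (len o) := ⟨(hlen o).ne'⟩
      exact Set.finite_range fun i : ZMod (len o) => point len o i
    refine ((Set.finite_singleton ∞).union h1).subset fun x hx => ?_
    induction x using point_cases with
    | infty => exact Or.inl rfl
    | point o i =>
      refine Or.inr ?_
      have h2 := Function.IsPeriodicPt.minimalPeriod_dvd (f := step len) (n := n) hx
      rw [minimalPeriod_step_coe] at h2
      simp only [Set.mem_iUnion]
      exact ⟨len o, Nat.mem_divisors.2 ⟨h2, by omega⟩, o, rfl, i, rfl⟩

/-- If each cycle of length `len o` is either fixed by the rotation by `k o = len o`, or has even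
length `2 * k o`, then rotating all cycles by `k` is an involution. -/
def halvingData {k : ω → ℕ} (hk : ∀ o, len o = k o ∨ len o = 2 * k o) :
    HalvingData (OnePoint (CycleUnion len)) where
  T := step len
  inv := rotateHomeo len k
  inv_continuous := (rotateHomeo len k).continuous
  inv_involutive x := by
    induction x using point_cases with
    | infty => rfl
    | point o i =>
      have h : len o ∣ k o + k o := by
        rcases hk o with h | h
        · rw [h]; exact dvd_add dvd_rfl dvd_rfl
        · rw [h, two_mul]
      rw [rotateHomeo_coe, rotateHomeo_coe, coe_mk_inj, add_assoc, ← Nat.cast_add,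
        (ZMod.natCast_eq_zero_iff _ _).2 h, add_zero]
  inv_comm x := by
    induction x using point_cases with
    | infty => rfl
    | point o i =>
      rw [step, rotateHomeo_coe, rotateHomeo_coe, rotateHomeo_coe, rotateHomeo_coe,
        add_right_comm]

theorem eq_or_eq_add_of_castHom_eq {n k : ℕ} (hk0 : 0 < k) (hk : n = k ∨ n = 2 * k)
    (hd : k ∣ n) {i j : ZMod n} (h : ZMod.castHom hd (ZMod k) i = ZMod.castHom hd (ZMod k) j) :
    i = j ∨ i = j + k := by
  have : NeZero n := ⟨by omega⟩
  have h0 : ZMod.castHom hd (ZMod k) (i - j) = 0 := by rw [map_sub, h, sub_self]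
  rw [ZMod.castHom_apply, ZMod.cast_eq_val, ZMod.natCast_eq_zero_iff] at h0
  obtain ⟨m, hm⟩ := h0
  have hlt := ZMod.val_lt (i - j)
  have hm2 : m < 2 := by
    by_contra hcon
    have := Nat.mul_le_mul_left k (not_lt.1 hcon)
    omega
  have hval : ((i - j).val : ZMod n) = i - j := ZMod.natCast_zmod_val _
  rw [hm] at hval
  interval_cases m
  · left
    rw [Nat.mul_zero, Nat.cast_zero] at hval
    exact (sub_eq_zero.1 hval.symm)
  · right
    rw [Nat.mul_one] at hval
    rw [hval]
    ring

/-- Halving a union of cycles of lengths `len o` gives a union of cycles of lengths `k o`. -/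
theorem orbitCount_halvedMap {k : ω → ℕ} (hk0 : ∀ o, 0 < k o)
    (hk : ∀ o, len o = k o ∨ len o = 2 * k o) (n : ℕ) :
    orbitCount (halvingData hk).halvedMap n = {o | cycleLength k o = n}.ncard := by
  have hd : ∀ o, k o ∣ len o := fun o => by
    rcases hk o with h | h
    · rw [h]
    · rw [h]; exact dvd_mul_left _ _
  set p : CycleUnion len → CycleUnion k := fun x => ⟨x.1, ZMod.castHom (hd x.1) (ZMod (k x.1)) x.2⟩
    with hp
  have hlift : ∀ x y, (halvingData hk).setoid x y → OnePoint.map p x = OnePoint.map p y := by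
    rintro x y (rfl | rfl)
    · rfl
    · induction y using point_cases with
      | infty => rfl
      | point o i =>
        change OnePoint.map p (rotateHomeo len k _) = _
        rw [rotateHomeo_coe]
        refine (coe_mk_inj k).2 ?_
        rw [map_add, map_natCast, ZMod.natCast_self, add_zero]
  set f : (halvingData hk).Halved → OnePoint (CycleUnion k) := Quotient.lift _ hlift with hf
  have hbij : Function.Bijective f := by
    constructor
    · rintro ⟨x⟩ ⟨y⟩ hxy
      refine Quotient.sound ?_
      have hxy' : OnePoint.map p x = OnePoint.map p y := hxy
      induction x using point_cases with
      | infty =>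
        induction y using point_cases with
        | infty => exact Or.inl rfl
        | point o' j => exact absurd hxy' (point_ne_infty k _ _).symm
      | point o i =>
        induction y using point_cases with
        | infty => exact absurd hxy' (point_ne_infty k _ _)
        | point o' j =>
          obtain rfl : o = o' := (Sigma.mk.inj (OnePoint.coe_eq_coe.1 hxy')).1
          rcases eq_or_eq_add_of_castHom_eq (hk0 o) (hk o) (hd o)
            ((coe_mk_inj k).1 hxy') with h | h
          · exact Or.inl (congrArg (point len o) h)
          · exact Or.inr (congrArg (point len o) h)
    · intro y
      induction y using point_cases with
      | infty => exact ⟨Quotient.mk _ ∞, rfl⟩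
      | point o j =>
        obtain ⟨i, rfl⟩ := ZMod.castHom_surjective (hd o) j
        exact ⟨Quotient.mk _ (point len o i), rfl⟩
  have hsemi : Function.Semiconj f (halvingData hk).halvedMap (step k) := by
    rintro ⟨x⟩
    induction x using point_cases with
    | infty => rfl
    | point o i =>
      change OnePoint.map p (rotateHomeo len _ (point len o i)) =
        rotateHomeo k _ (point k o (ZMod.castHom (hd o) (ZMod (k o)) i))
      rw [rotateHomeo_coe, rotateHomeo_coe]
      refine (coe_mk_inj k).2 ?_
      rw [map_add, Nat.cast_one, map_one, Nat.cast_one]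
  rw [hsemi.orbitCount_eq hbij, orbitCount_step hk0]

theorem ncard_cycleLength_eq {n : ℕ} (hfin : {o | len o = n}.Finite) :
    {o | cycleLength len o = n}.ncard = {o | len o = n}.ncard + if n = 1 then 1 else 0 := by
  have hset : {o | cycleLength len o = n} =
      some '' {o | len o = n} ∪ if n = 1 then {none} else ∅ := by
    ext o
    cases o with
    | none => by_cases h : n = 1 <;> simp [cycleLength, h, eq_comm]
    | some o => by_cases h : n = 1 <;> simp [cycleLength, h]
  have hdisj : Disjoint (some '' {o | len o = n}) (if n = 1 then {none} else ∅) := by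
    split_ifs <;> simp
  rw [hset, Set.ncard_union_eq hdisj (hfin.image _) (by split_ifs <;> simp),
    Set.ncard_image_of_injective _ (Option.some_injective ω)]
  congr 1
  split_ifs <;> simp

theorem ncard_sumElim_eq {α β : Type*} {f : α → ℕ} {g : β → ℕ} {n : ℕ}
    (hf : {x | f x = n}.Finite) (hg : {x | g x = n}.Finite) :
    {o | Sum.elim f g o = n}.Finite ∧
      {o | Sum.elim f g o = n}.ncard = {x | f x = n}.ncard + {x | g x = n}.ncard := by
  have hset : {o | Sum.elim f g o = n} = Sum.inl '' {x | f x = n} ∪ Sum.inr '' {x | g x = n} := by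
    ext o
    cases o <;> simp
  rw [hset]
  refine ⟨(hf.image _).union (hg.image _), ?_⟩
  rw [Set.ncard_union_eq (by simp [Set.disjoint_left]) (hf.image _) (hg.image _),
    Set.ncard_image_of_injective _ Sum.inl_injective,
    Set.ncard_image_of_injective _ Sum.inr_injective]

theorem ncard_sigma_fst_eq (s : ℕ → ℕ) (n : ℕ) :
    {x : Σ m, Fin (s m) | x.1 = n}.Finite ∧ {x : Σ m, Fin (s m) | x.1 = n}.ncard = s n := by
  have hset : {x : Σ m, Fin (s m) | x.1 = n} = Set.range (Sigma.mk n) := by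
    ext ⟨m, i⟩
    constructor
    · rintro rfl
      exact ⟨i, rfl⟩
    · rintro ⟨j, hj⟩
      exact (Sigma.mk.inj hj).1.symm
  rw [hset]
  refine ⟨Set.finite_range _, ?_⟩
  rw [← Set.image_univ, Set.ncard_image_of_injective _ sigma_mk_injective, Set.ncard_univ,
    Nat.card_fin]

theorem ncard_sigma_two_mul_fst_eq (t : ℕ → ℕ) (n : ℕ) :
    {x : Σ m, Fin (t m) | 2 * x.1 = n}.Finite ∧
      {x : Σ m, Fin (t m) | 2 * x.1 = n}.ncard = if Even n then t (n / 2) else 0 := by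
  by_cases h : Even n
  · obtain ⟨m, rfl⟩ := h.two_dvd
    have := ncard_sigma_fst_eq t m
    simpa using this
  · have : {x : Σ m, Fin (t m) | 2 * x.1 = n} = ∅ := by
      ext x
      simp only [Set.mem_ofPred_eq, Set.mem_empty_iff_false, iff_false]
      rintro rfl
      exact h (even_two_mul _)
    simp [this, h]

end CycleUnion

/-- There is a system with an involution in which, apart from a fixed point, the involution fixes
`s n` closed orbits of length `n` pointwise and rotates `t n` closed orbits of length `2 * n` by
half a turn. The latter become orbits of length `n` of the halved system. -/
theorem exists_halvingData (s t : ℕ → ℕ) (hs : s 0 = 0) (ht : t 0 = 0) :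
    ∃ (X : Type) (_ : MetricSpace X) (H : HalvingData X),
      IsTopDynSystem H.T ∧ IsTopDynSystem H.halvedMap ∧
      ∀ n : ℕ,
        orbitCount H.T n = s n + (if Even n then t (n / 2) else 0) + (if n = 1 then 1 else 0) ∧
        orbitCount H.halvedMap n = s n + t n + (if n = 1 then 1 else 0) := by
  set k : ((Σ n, Fin (s n)) ⊕ (Σ n, Fin (t n))) → ℕ := Sum.elim (fun x => x.1) fun x => x.1 with hk
  set len : ((Σ n, Fin (s n)) ⊕ (Σ n, Fin (t n))) → ℕ :=
    Sum.elim (fun x => x.1) fun x => 2 * x.1 with hlen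
  have hk0 : ∀ o, 0 < k o := by
    rintro (⟨n, i⟩ | ⟨n, i⟩)
    · refine Nat.pos_of_ne_zero ?_
      rintro (rfl : n = 0)
      exact Fin.elim0 (hs ▸ i)
    · refine Nat.pos_of_ne_zero ?_
      rintro (rfl : n = 0)
      exact Fin.elim0 (ht ▸ i)
  have hkl : ∀ o, len o = k o ∨ len o = 2 * k o := by
    rintro (x | x)
    · exact Or.inl rfl
    · exact Or.inr rfl
  have hlen0 : ∀ o, 0 < len o := fun o => by
    have := hk0 o
    rcases hkl o with h | h <;> omega
  have hcl := fun n => CycleUnion.ncard_sumElim_eq (CycleUnion.ncard_sigma_fst_eq s n).1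
    (CycleUnion.ncard_sigma_two_mul_fst_eq t n).1
  have hck := fun n => CycleUnion.ncard_sumElim_eq (CycleUnion.ncard_sigma_fst_eq s n).1
    (CycleUnion.ncard_sigma_fst_eq t n).1
  have hsys : IsTopDynSystem (CycleUnion.halvingData hkl).T :=
    CycleUnion.isTopDynSystem_step hlen0 fun n => (hcl n).1
  have := hsys.metrizable
  refine ⟨OnePoint (CycleUnion len), TopologicalSpace.metrizableSpaceMetric _,
    CycleUnion.halvingData hkl, hsys, HalvingData.isTopDynSystem_halvedMap _ hsys,
    fun n => ⟨?_, ?_⟩⟩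
  · refine (CycleUnion.orbitCount_step hlen0 n).trans ?_
    rw [CycleUnion.ncard_cycleLength_eq (hcl n).1, (hcl n).2, (CycleUnion.ncard_sigma_fst_eq s n).2,
      (CycleUnion.ncard_sigma_two_mul_fst_eq t n).2]
  · refine (CycleUnion.orbitCount_halvedMap hk0 hkl n).trans ?_
    rw [CycleUnion.ncard_cycleLength_eq (hck n).1, (hck n).2, (CycleUnion.ncard_sigma_fst_eq s n).2,
      (CycleUnion.ncard_sigma_fst_eq t n).2]

/-! ### Polynomials that are small off an arc of the unit circle -/

section Fejer

open Polynomial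

/-- The analytic completion of the Fejér kernel, without its constant term:
`fejer N = (2 / (N + 1)) ∑_{j = 1}^{N} (N + 1 - j) X ^ j`. -/
noncomputable def fejer (N : ℕ) : ℂ[X] :=
  C (2 / ((N : ℂ) + 1)) * ∑ k ∈ Finset.range N, ∑ j ∈ Finset.range (k + 1), X ^ (j + 1)

theorem fejer_natDegree_le (N : ℕ) : (fejer N).natDegree ≤ N := by
  refine (natDegree_C_mul_le _ _).trans (natDegree_sum_le_of_forall_le _ _ fun k hk => ?_)
  refine natDegree_sum_le_of_forall_le _ _ fun j hj => ?_
  have := Finset.mem_range.1 hk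
  have := Finset.mem_range.1 hj
  exact (natDegree_X_pow_le _).trans (by omega)

theorem fejer_coeff_zero (N : ℕ) : (fejer N).coeff 0 = 0 := by
  simp [fejer, coeff_zero_eq_eval_zero, eval_finsetSum]

/-- On the unit circle the real part of `fejer N` is the Fejér kernel minus its mean value `1`. -/
theorem re_fejer_eval (N : ℕ) {z : ℂ} (hz : ‖z‖ = 1) :
    ((fejer N).eval z).re = ‖∑ j ∈ Finset.range (N + 1), z ^ j‖ ^ 2 / (N + 1) - 1 := by
  have key : ∀ N : ℕ, ‖∑ j ∈ Finset.range (N + 1), z ^ j‖ ^ 2 =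
      (N + 1) + 2 * (∑ k ∈ Finset.range N, ∑ j ∈ Finset.range (k + 1), z ^ (j + 1)).re := by
    intro N
    induction N with
    | zero => simp
    | succ N ih =>
      rw [Finset.sum_range_succ, ← Complex.normSq_eq_norm_sq, Complex.normSq_add,
        Complex.normSq_eq_norm_sq, Complex.normSq_eq_norm_sq, ih,
        Finset.sum_range_succ fun k => ∑ j ∈ Finset.range (k + 1), z ^ (j + 1),
        Complex.add_re, norm_pow, hz]
      have h : (∑ j ∈ Finset.range (N + 1), z ^ j) * (starRingEnd ℂ) (z ^ (N + 1)) =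
          (starRingEnd ℂ) (∑ j ∈ Finset.range (N + 1), z ^ (j + 1)) := by
        rw [← Finset.sum_range_reflect, map_sum, Finset.sum_mul]
        refine Finset.sum_congr rfl fun j hj => ?_
        have hj' := Finset.mem_range.1 hj
        have hzz : z * (starRingEnd ℂ) z = 1 := by
          rw [Complex.mul_conj, Complex.normSq_eq_norm_sq, hz]; simp
        rw [show N + 1 - 1 - j = N - j by omega, map_pow, map_pow,
          show N + 1 = (N - j) + (j + 1) by omega, pow_add, ← mul_assoc, ← mul_pow]
        rw [hzz, one_pow, one_mul]
      rw [h, Complex.conj_re]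
      push_cast
      ring
  have hN : (0 : ℝ) < N + 1 := by positivity
  have h2 : (2 / ((N : ℂ) + 1)) = ((2 / ((N : ℝ) + 1) : ℝ) : ℂ) := by push_cast; rfl
  rw [key, fejer, eval_mul, eval_C, h2, Complex.re_ofReal_mul]
  simp only [eval_finsetSum, eval_pow, eval_X]
  field_simp
  ring

/-- For each arc around `1` there is a polynomial `q` with `q(0) = 1` that has absolute value at most
`ρ < 1` on an annular neighbourhood of the rest of the circle, and at most `ρ * |z| ^ N` on the circle
`|z| = e ^ η`, where `N` bounds its degree. It is `1 + t * fejer N` for small `t`. -/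
theorem exists_polynomial_small_off_arc {α η₀ : ℝ} (hα : 0 < α) (hαπ : α < Real.pi) (hη₀ : 0 < η₀) :
    ∃ (N : ℕ) (q : ℂ[X]) (η ρ : ℝ), 1 ≤ N ∧ q.natDegree ≤ N ∧ q.coeff 0 = 1 ∧ 0 < η ∧ η ≤ η₀ ∧
      0 < ρ ∧ ρ < 1 ∧
      (∀ s : ℂ, |s.re| ≤ η → α ≤ |s.im| → |s.im| ≤ Real.pi → ‖q.eval (Complex.exp s)‖ ≤ ρ) ∧
      (∀ s : ℂ, s.re = η → ‖q.eval (Complex.exp s)‖ ≤ ρ * Real.exp (η * N)) := by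
  -- a lower bound for `|z - 1|` off the arc
  set A : Set ℝ := {y | α ≤ |y| ∧ |y| ≤ Real.pi} with hA
  have hAc : IsCompact A := by
    refine (isCompact_Icc (a := -Real.pi) (b := Real.pi)).of_isClosed_subset ?_ ?_
    · exact (isClosed_le continuous_const continuous_abs).inter
        (isClosed_le continuous_abs continuous_const)
    · intro y hy
      exact abs_le.1 hy.2
  have hne : ∀ y ∈ A, Complex.exp (y * Complex.I) - 1 ≠ 0 := by
    intro y hy h
    rw [sub_eq_zero, Complex.exp_eq_one_iff] at h
    obtain ⟨n, hn⟩ := h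
    have hy2 : y = n * (2 * Real.pi) := by
      have : (y : ℂ) * Complex.I = ((n * (2 * Real.pi) : ℝ) : ℂ) * Complex.I := by
        rw [hn]; push_cast; ring
      exact_mod_cast mul_right_cancel₀ Complex.I_ne_zero this
    have hn0 : n = 0 := by
      by_contra hcon
      have h1 : (1 : ℝ) ≤ |(n : ℝ)| := by exact_mod_cast Int.one_le_abs hcon
      have h2 := hy.2
      rw [hy2, abs_mul, abs_of_pos (by positivity : (0 : ℝ) < 2 * Real.pi)] at h2
      nlinarith [Real.pi_pos]
    have h1 := hy.1
    rw [hy2, hn0] at h1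
    simp at h1
    linarith
  have hcont : ContinuousOn (fun y : ℝ => ‖Complex.exp (y * Complex.I) - 1‖) A := by
    fun_prop
  obtain ⟨y₀, hy₀, hmin⟩ := hAc.exists_isMinOn ⟨α, by rw [hA]; simp [abs_of_pos hα, hαπ.le]⟩ hcont
  set κ := ‖Complex.exp (y₀ * Complex.I) - 1‖ with hκ
  have hκ0 : 0 < κ := norm_pos_iff.2 (hne y₀ hy₀)
  obtain ⟨N, hN⟩ := exists_nat_ge (max 1 (8 / κ ^ 2))
  have hN1 : 1 ≤ N := by exact_mod_cast (le_max_left _ _).trans hN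
  have hN2 : 8 / κ ^ 2 ≤ N := (le_max_right _ _).trans hN
  -- the real part of `fejer N` is at most `- 1 / 2` off the arc
  have hre : ∀ y ∈ A, ((fejer N).eval (Complex.exp (y * Complex.I))).re ≤ -(1 / 2) := by
    intro y hy
    have hz : ‖Complex.exp (y * Complex.I)‖ = 1 := Complex.norm_exp_ofReal_mul_I y
    rw [re_fejer_eval N hz, geom_sum_eq (sub_ne_zero.1 (hne y hy)), norm_div, div_pow]
    have h1 : ‖Complex.exp (y * Complex.I) ^ (N + 1) - 1‖ ≤ 2 := by
      refine (norm_sub_le _ _).trans ?_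
      rw [norm_pow, hz]
      norm_num
    have h2 : κ ≤ ‖Complex.exp (y * Complex.I) - 1‖ := hmin hy
    have h3 : ‖Complex.exp (y * Complex.I) ^ (N + 1) - 1‖ ^ 2 /
        ‖Complex.exp (y * Complex.I) - 1‖ ^ 2 ≤ 2 ^ 2 / κ ^ 2 := by gcongr
    have h4 : 2 ^ 2 / κ ^ 2 ≤ (N + 1) * (1 / 2 : ℝ) := by
      have : (2 : ℝ) ^ 2 / κ ^ 2 = (8 / κ ^ 2) * (1 / 2) := by ring
      rw [this]
      nlinarith
    have h5 := div_le_of_le_mul₀ (by positivity) (by positivity)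
      ((h3.trans h4).trans_eq (mul_comm _ _))
    linarith
  -- by compactness it is less than `- 1 / 4` on a neighbourhood
  have hnear : ∀ᶠ x : ℝ in nhds 0, ∀ y ∈ A,
      ((fejer N).eval (Complex.exp ((x : ℂ) + y * Complex.I))).re < -(1 / 4) := by
    refine hAc.eventually_forall_of_forall_eventually fun y hy => ?_
    have hc : Continuous fun p : ℝ × ℝ =>
        ((fejer N).eval (Complex.exp (p.1 + p.2 * Complex.I))).re := by
      refine Complex.continuous_re.comp ((fejer N).continuous.comp ?_)
      fun_prop
    refine hc.continuousAt.eventually_lt continuousAt_const ?_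
    have := hre y hy
    simp only [Complex.ofReal_zero, zero_add]
    linarith
  obtain ⟨η₁, hη₁, hη₁'⟩ := Metric.eventually_nhds_iff.1 hnear
  set η := min (min η₀ (η₁ / 2)) 1 with hη
  have hη0 : 0 < η := by positivity
  have hη1 : η ≤ 1 := min_le_right _ _
  have hηη₁ : η < η₁ := by
    have : η ≤ η₁ / 2 := (min_le_left _ _).trans (min_le_right _ _)
    linarith
  obtain ⟨K', hK'⟩ := (isCompact_closedBall (0 : ℂ) (Real.exp 1)).exists_bound_of_continuousOn
    (fejer N).continuous.continuousOn
  set K := max K' 1 with hKdef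
  have hK1 : 1 ≤ K := le_max_right _ _
  have hK : ∀ s : ℂ, s.re ≤ 1 → ‖(fejer N).eval (Complex.exp s)‖ ≤ K := by
    intro s hs
    refine (hK' _ ?_).trans (le_max_left _ _)
    rw [mem_closedBall_zero_iff, Complex.norm_exp]
    exact Real.exp_le_exp.2 hs
  -- the factor `t` has to beat the quadratic term off the arc and the growth on the arc
  set t := min (1 / (4 * K ^ 2)) (η / (2 * K)) with ht
  have ht0 : 0 < t := by positivity
  have ht1 : t * K ^ 2 ≤ 1 / 4 := by
    have : t ≤ 1 / (4 * K ^ 2) := min_le_left _ _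
    rw [le_div_iff₀ (by positivity)] at this
    linarith
  have ht2 : t * K ≤ η / 2 := by
    have : t ≤ η / (2 * K) := min_le_right _ _
    rw [le_div_iff₀ (by positivity)] at this
    linarith
  have ht3 : t ≤ 1 / 4 := by
    have : t * 1 ≤ t * K ^ 2 := by gcongr; exact one_le_pow₀ hK1
    linarith
  refine ⟨N, 1 + C (t : ℂ) * fejer N, η, 1 - t / 8, hN1, ?_, ?_, hη0,
    (min_le_left _ _).trans (min_le_left _ _), by linarith, by linarith, ?_, ?_⟩
  · refine (natDegree_add_le _ _).trans (max_le (by simp) ?_)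
    exact (natDegree_C_mul_le _ _).trans (fejer_natDegree_le N)
  · simp [fejer_coeff_zero]
  · intro s hs h1 h2
    have hs' : s = s.re + s.im * Complex.I := (Complex.re_add_im s).symm
    have h3 : ((fejer N).eval (Complex.exp s)).re < -(1 / 4) := by
      rw [hs']
      refine hη₁' (y := s.re) ?_ s.im ⟨h1, h2⟩
      rw [Real.dist_eq, sub_zero]
      linarith
    have h4 := hK s ((le_abs_self _).trans (hs.trans hη1))
    rw [eval_add, eval_one, eval_mul, eval_C]
    set h := (fejer N).eval (Complex.exp s)
    refine le_of_sq_le_sq ?_ (by linarith)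
    rw [← Complex.normSq_eq_norm_sq, Complex.normSq_add, Complex.normSq_eq_norm_sq,
      Complex.normSq_eq_norm_sq, norm_mul, Complex.norm_of_nonneg ht0.le, norm_one, map_mul,
      Complex.conj_ofReal, one_mul, Complex.re_ofReal_mul, Complex.conj_re]
    have h5 : ‖h‖ ^ 2 ≤ K ^ 2 := by gcongr
    have h6 : t * (t * ‖h‖ ^ 2) ≤ t * (1 / 4) := by
      gcongr
      exact (mul_le_mul_of_nonneg_left h5 ht0.le).trans ht1
    nlinarith
  · intro s hs
    have h4 := hK s (hs.le.trans hη1)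
    rw [eval_add, eval_one, eval_mul, eval_C]
    have h5 : ‖1 + (t : ℂ) * (fejer N).eval (Complex.exp s)‖ ≤ 1 + t * K := by
      refine (norm_add_le _ _).trans ?_
      rw [norm_one, norm_mul, Complex.norm_of_nonneg ht0.le]
      gcongr
    have h6 : 1 + η ≤ Real.exp (η * N) := by
      have : η * 1 ≤ η * N := by gcongr; exact_mod_cast hN1
      have := Real.add_one_le_exp (η * N)
      linarith
    have h7 : (1 - t / 8) * (1 + η) ≤ (1 - t / 8) * Real.exp (η * N) := by
      gcongr
      linarith
    nlinarith

end Fejer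

/-! ### Moving the contour across a regular arc -/

section Keyhole

open Complex MeasureTheory

/-- The image under the logarithm of the contour that follows the circle `|z| = e ^ a`, except
that for arguments in `[-α, α]` it moves out to the circle `|z| = e ^ b`. -/
def keyhole (a b α : ℝ) : Set ℂ :=
  {s | (s.re = a ∧ α ≤ |s.im| ∧ |s.im| ≤ Real.pi) ∨
    ((a ≤ s.re ∧ s.re ≤ b) ∧ |s.im| = α) ∨ (s.re = b ∧ |s.im| ≤ α)}

theorem isCompact_keyhole {a b α : ℝ} (hab : a ≤ b) (hα : α ≤ Real.pi) :
    IsCompact (keyhole a b α) := by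
  have him : Continuous fun s : ℂ => |s.im| := continuous_abs.comp continuous_im
  have h : keyhole a b α ⊆ Set.Icc a b ×ℂ Set.Icc (-Real.pi) Real.pi := by
    rintro s (⟨h1, -, h2⟩ | ⟨h1, h2⟩ | ⟨h1, h2⟩)
    · exact ⟨⟨h1.ge, h1.le.trans hab⟩, abs_le.1 h2⟩
    · exact ⟨h1, abs_le.1 (h2.le.trans hα)⟩
    · exact ⟨⟨hab.trans h1.ge, h1.le⟩, abs_le.1 (h2.trans hα)⟩
  refine (isCompact_Icc.reProdIm isCompact_Icc).of_isClosed_subset ?_ h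
  refine IsClosed.union ?_ (IsClosed.union ?_ ?_)
  · exact (isClosed_eq continuous_re continuous_const).inter
      ((isClosed_le continuous_const him).inter (isClosed_le him continuous_const))
  · exact ((isClosed_le continuous_const continuous_re).inter
      (isClosed_le continuous_re continuous_const)).inter (isClosed_eq him continuous_const)
  · exact (isClosed_eq continuous_re continuous_const).inter (isClosed_le him continuous_const)

/-- By Cauchy's theorem for a rectangle, applied in logarithmic coordinates, a bound on the keyhole
contour bounds the integral over the circle. -/
theorem norm_circleIntegral_le_of_keyhole {F : ℂ → ℂ} {a b α M : ℝ} (hab : a ≤ b) (hα : 0 ≤ α)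
    (hαπ : α ≤ Real.pi) (hc : ContinuousOn F (Metric.sphere 0 (Real.exp a)))
    (hd : DifferentiableOn ℂ (fun s => F (exp s)) (Set.Icc a b ×ℂ Set.Icc (-α) α))
    (hM : ∀ s ∈ keyhole a b α, ‖F (exp s)‖ ≤ M) :
    ‖∮ z in C(0, Real.exp a), z⁻¹ * F z‖ ≤ (2 * Real.pi + 2 * (b - a)) * M := by
  set K : ℂ → ℂ := fun s => F (exp s) with hK
  set φ : ℝ → ℂ := fun y => K (a + y * I) with hφ
  have hcirc : ∀ y : ℝ, exp (a + y * I) = circleMap 0 (Real.exp a) y := fun y => by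
    rw [circleMap_zero, exp_add, ofReal_exp]
  have h1 : (∮ z in C(0, Real.exp a), z⁻¹ * F z) = I * ∫ y in (-Real.pi)..Real.pi, φ y := by
    have hper : Function.Periodic φ (2 * Real.pi) := fun y => by
      simp only [hφ, hK, hcirc]
      rw [periodic_circleMap]
    have h2 := hper.intervalIntegral_add_eq 0 (-Real.pi)
    rw [zero_add, show -Real.pi + 2 * Real.pi = Real.pi by ring] at h2
    rw [circleIntegral, ← h2, ← intervalIntegral.integral_const_mul]
    refine intervalIntegral.integral_congr fun y _ => ?_
    simp only [hφ, hK, hcirc, deriv_circleMap, smul_eq_mul]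
    have hne : circleMap 0 (Real.exp a) y ≠ 0 := circleMap_ne_center (Real.exp_pos a).ne'
    field_simp
  have hcont : Continuous φ := by
    have h2 : φ = fun y => F (circleMap 0 (Real.exp a) y) := by
      funext y
      simp only [hφ, hK, hcirc]
    rw [h2]
    exact hc.comp_continuous (continuous_circleMap _ _)
      fun y => circleMap_mem_sphere _ (Real.exp_pos a).le y
  have hint : ∀ x y : ℝ, IntervalIntegrable φ volume x y := fun x y => hcont.intervalIntegrable x y
  have hsplit : ∫ y in (-Real.pi)..Real.pi, φ y =
      (∫ y in (-Real.pi)..(-α), φ y) + (∫ y in (-α)..α, φ y) + ∫ y in α..Real.pi, φ y := by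
    rw [intervalIntegral.integral_add_adjacent_intervals (hint _ _) (hint _ _),
      intervalIntegral.integral_add_adjacent_intervals (hint _ _) (hint _ _)]
  have hrect := integral_boundary_rect_eq_zero_of_differentiableOn K ⟨a, -α⟩ ⟨b, α⟩ (by
    rwa [Set.uIcc_of_le hab, Set.uIcc_of_le (by linarith : -α ≤ α)])
  simp only [smul_eq_mul] at hrect
  -- bounds for the five pieces of the contour
  have b1 : ‖∫ y in (-Real.pi)..(-α), φ y‖ ≤ M * |-α - -Real.pi| := by
    refine intervalIntegral.norm_integral_le_of_norm_le_const fun y hy => hM _ (Or.inl ?_)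
    rw [Set.uIoc_of_le (by linarith)] at hy
    have : |y| = -y := abs_of_nonpos (by linarith [hy.2])
    simp only [add_re, ofReal_re, mul_re, I_re, mul_zero, ofReal_im, I_im, mul_one, sub_self,
      add_zero, add_im, mul_im, zero_add, this, true_and]
    exact ⟨by linarith [hy.2], by linarith [hy.1]⟩
  have b2 : ‖∫ y in α..Real.pi, φ y‖ ≤ M * |Real.pi - α| := by
    refine intervalIntegral.norm_integral_le_of_norm_le_const fun y hy => hM _ (Or.inl ?_)
    rw [Set.uIoc_of_le hαπ] at hy
    have : |y| = y := abs_of_nonneg (by linarith [hy.1])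
    simp only [add_re, ofReal_re, mul_re, I_re, mul_zero, ofReal_im, I_im, mul_one, sub_self,
      add_zero, add_im, mul_im, zero_add, this, true_and]
    exact ⟨hy.1.le, hy.2⟩
  have b3 : ∀ y : ℝ, |y| = α → ‖∫ x in a..b, K (x + y * I)‖ ≤ M * |b - a| := by
    intro y hy
    refine intervalIntegral.norm_integral_le_of_norm_le_const fun x hx => hM _ (Or.inr (Or.inl ?_))
    rw [Set.uIoc_of_le hab] at hx
    simp only [add_re, ofReal_re, mul_re, I_re, mul_zero, ofReal_im, I_im, mul_one, sub_self,
      add_zero, add_im, mul_im, zero_add, hy, and_true]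
    exact ⟨hx.1.le, hx.2⟩
  have b4 : ‖∫ y in (-α)..α, K (b + y * I)‖ ≤ M * |α - -α| := by
    refine intervalIntegral.norm_integral_le_of_norm_le_const fun y hy => hM _ (Or.inr (Or.inr ?_))
    rw [Set.uIoc_of_le (by linarith)] at hy
    simp only [add_re, ofReal_re, mul_re, I_re, mul_zero, ofReal_im, I_im, mul_one, sub_self,
      add_zero, add_im, mul_im, zero_add, true_and]
    exact abs_le.2 ⟨hy.1.le, hy.2⟩
  have b5 := b3 (-α) (by rw [abs_neg, abs_of_nonneg hα])
  have b6 := b3 α (abs_of_nonneg hα)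
  have hmid : I * ∫ y in (-α)..α, φ y = (∫ x in a..b, K (x + (-α : ℝ) * I)) -
      (∫ x in a..b, K (x + α * I)) + I * ∫ y in (-α)..α, K (b + y * I) := by
    linear_combination -hrect
  rw [h1, hsplit, mul_add, mul_add, hmid]
  rw [abs_of_nonneg (by linarith)] at b1 b2 b4 b5 b6
  have hI : ∀ w : ℂ, ‖I * w‖ = ‖w‖ := fun w => by rw [norm_mul, norm_I, one_mul]
  refine (norm_add_le _ _).trans ?_
  refine (add_le_add ((norm_add_le _ _).trans
    (add_le_add_right (norm_add_le _ _) _)) le_rfl).trans ?_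
  refine (add_le_add (add_le_add le_rfl (add_le_add (norm_sub_le _ _) le_rfl)) le_rfl).trans ?_
  rw [hI, hI, hI]
  linarith

theorem eq_circleIntegral_of_hasSum {γ : ℕ → ℂ} {Φ : ℂ → ℂ}
    (hsum : ∀ z : ℂ, ‖z‖ < 1 → HasSum (fun n => γ n * z ^ n) (Φ z))
    (hΦ : DifferentiableOn ℂ Φ (Metric.ball 0 1)) {r : ℝ} (hr0 : 0 < r) (hr1 : r < 1) (n : ℕ) :
    γ n = (2 * Real.pi * I)⁻¹ * ∮ z in C(0, r), z⁻¹ * (Φ z * (z⁻¹) ^ n) := by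
  have h1 : HasFPowerSeriesAt Φ (FormalMultilinearSeries.ofScalars ℂ γ) 0 := by
    rw [hasFPowerSeriesAt_iff]
    filter_upwards [Metric.ball_mem_nhds (0 : ℂ) one_pos] with z hz
    simp only [FormalMultilinearSeries.coeff_ofScalars, zero_add, smul_eq_mul, mul_comm (z ^ _)]
    exact hsum z (mem_ball_zero_iff.1 hz)
  lift r to NNReal using hr0.le
  have h2 := (hΦ.mono (Metric.closedBall_subset_ball hr1)).hasFPowerSeriesOnBall
    (by exact_mod_cast hr0)
  have h3 := congrArg (fun p : FormalMultilinearSeries ℂ ℂ ℂ => p n fun _ => 1)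
    (h1.eq_formalMultilinearSeries h2.hasFPowerSeriesAt)
  simp only [cauchyPowerSeries_apply, smul_eq_mul, sub_zero, one_div] at h3
  have h4 : (FormalMultilinearSeries.ofScalars ℂ γ n fun _ => (1 : ℂ)) = γ n :=
    FormalMultilinearSeries.coeff_ofScalars
  rw [← h4, h3]
  congr 1
  refine circleIntegral.integral_congr r.2 fun z _ => ?_
  ring

/-- Cauchy's formula for the coefficients of the product of a power series and a polynomial. -/
theorem coeff_mul_eq_circleIntegral {γ : ℕ → ℂ} {Φ : ℂ → ℂ}
    (hsum : ∀ z : ℂ, ‖z‖ < 1 → HasSum (fun n => γ n * z ^ n) (Φ z))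
    (hΦ : DifferentiableOn ℂ Φ (Metric.ball 0 1)) {r : ℝ} (hr0 : 0 < r)
    (hr1 : r < 1) (P : Polynomial ℂ) {n : ℕ} (hP : P.natDegree ≤ n) :
    PowerSeries.coeff n ((P : PowerSeries ℂ) * PowerSeries.mk γ) =
      (2 * Real.pi * I)⁻¹ * ∮ z in C(0, r), z⁻¹ * (P.eval z * Φ z * (z⁻¹) ^ n) := by
  have hne : ∀ z ∈ Metric.sphere (0 : ℂ) r, z ≠ 0 := fun z hz h => by
    rw [mem_sphere_zero_iff_norm, h, norm_zero] at hz
    exact hr0.ne hz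
  have hcΦ : ContinuousOn Φ (Metric.sphere 0 r) :=
    hΦ.continuousOn.mono fun z hz => by
      rw [mem_ball_zero_iff, mem_sphere_zero_iff_norm.1 hz]
      exact hr1
  have hinv : ContinuousOn (fun z : ℂ => z⁻¹) (Metric.sphere 0 r) :=
    continuousOn_id.inv₀ hne
  have hint : ∀ k ∈ Finset.range (n + 1), CircleIntegrable
      (fun z => P.coeff k * (z⁻¹ * (Φ z * (z⁻¹) ^ (n - k)))) 0 r := fun k _ =>
    (continuousOn_const.mul (hinv.mul (hcΦ.mul (hinv.pow _)))).circleIntegrable hr0.le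
  have h1 : (∮ z in C(0, r), z⁻¹ * (P.eval z * Φ z * (z⁻¹) ^ n)) =
      ∑ k ∈ Finset.range (n + 1), P.coeff k *
        ∮ z in C(0, r), z⁻¹ * (Φ z * (z⁻¹) ^ (n - k)) := by
    simp only [← circleIntegral.integral_const_mul]
    rw [← circleIntegral.integral_fun_sum hint]
    refine circleIntegral.integral_congr hr0.le fun z hz => ?_
    rw [Polynomial.eval_eq_sum_range' (Nat.lt_succ_of_le hP), Finset.sum_mul, Finset.sum_mul,
      Finset.mul_sum]
    refine Finset.sum_congr rfl fun k hk => ?_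
    have hk' : n = k + (n - k) := by have := Finset.mem_range.1 hk; omega
    have h2 : z ^ k * (z⁻¹) ^ n = (z⁻¹) ^ (n - k) := by
      conv_lhs => rw [hk', pow_add, ← mul_assoc, ← mul_pow, mul_inv_cancel₀ (hne z hz), one_pow,
        one_mul]
    rw [← h2]
    ring
  rw [h1, Finset.mul_sum, PowerSeries.coeff_mul, Finset.Nat.sum_antidiagonal_eq_sum_range_succ_mk]
  refine Finset.sum_congr rfl fun k _ => ?_
  rw [Polynomial.coeff_coe, PowerSeries.coeff_mk,
    eq_circleIntegral_of_hasSum hsum hΦ hr0 hr1 (n - k)]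
  ring

/-- If a power series on the unit disc continues across `1`, then the coefficients of its products
with `B * q ^ i` decay geometrically in `i`, where `q` is a fixed polynomial with `q(0) = 1`. What is
lost, the factor `E ^ l`, is small enough compared with the gain `θ ^ i` when `l ≤ 2 * i`. -/
theorem exists_coeff_mul_pow_bound {γ : ℕ → ℂ} {Φ : ℂ → ℂ} {ε : ℝ} (hε : 0 < ε)
    (hsum : ∀ z : ℂ, ‖z‖ < 1 → HasSum (fun n => γ n * z ^ n) (Φ z))
    (hΦ : DifferentiableOn ℂ Φ (Metric.ball 0 1 ∪ Metric.ball 1 ε)) :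
    ∃ (N : ℕ) (q : Polynomial ℂ) (θ E C : ℝ), 1 ≤ N ∧ q.natDegree ≤ N ∧ q.coeff 0 = 1 ∧
      0 < θ ∧ 1 ≤ E ∧ E ^ 2 * θ < 1 ∧ 0 ≤ C ∧
      ∀ (B : Polynomial ℂ) (m l i j : ℕ) (β : ℝ), B.natDegree ≤ m → m ≤ N * l → j ≤ N →
        (∀ k, ‖B.coeff k‖ ≤ β) →
        ‖PowerSeries.coeff (m + N * i + j)
          (((B * q ^ i : Polynomial ℂ) : PowerSeries ℂ) * PowerSeries.mk γ)‖ ≤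
          C * ((m + 1) * β) * (E ^ l * θ ^ i) := by
  -- a rectangle that the exponential map sends into the domain of `Φ`
  have hexp : ∀ᶠ s in nhds (0 : ℂ), exp s ∈ Metric.ball (1 : ℂ) ε := by
    have : Filter.Tendsto exp (nhds 0) (nhds 1) := by
      simpa using continuous_exp.tendsto (0 : ℂ)
    exact this.eventually (Metric.ball_mem_nhds 1 hε)
  obtain ⟨R, hR0, hR⟩ := Metric.eventually_nhds_iff.1 hexp
  set α := min (R / 3) 1 with hαdef
  have hα0 : 0 < α := by positivity
  have hα1 : α ≤ 1 := min_le_right _ _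
  have hαR : α ≤ R / 3 := min_le_left _ _
  have hαπ : α < Real.pi := by linarith [Real.pi_gt_three]
  obtain ⟨N, q, η, ρ, hN, hqN, hq0, hη0, hηα, hρ0, hρ1, hoff, hon⟩ :=
    exists_polynomial_small_off_arc hα0 hαπ (η₀ := α) hα0
  have hrect : ∀ s : ℂ, |s.re| ≤ α → |s.im| ≤ α → exp s ∈ Metric.ball (1 : ℂ) ε := by
    intro s h1 h2
    refine hR ?_
    rw [dist_zero_right]
    have := norm_le_abs_re_add_abs_im s
    linarith
  -- the radius `e ^ (-δ)` is chosen after `ρ`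
  obtain ⟨δ, hδ0, hδη, hδ⟩ : ∃ δ : ℝ, 0 < δ ∧ δ ≤ η ∧ Real.exp (3 * N * δ) * ρ < 1 := by
    have hcont : Filter.Tendsto (fun δ : ℝ => Real.exp (3 * N * δ) * ρ) (nhdsWithin 0 (Set.Ioi 0))
        (nhds ρ) := by
      have : Continuous fun δ : ℝ => Real.exp (3 * N * δ) * ρ := by fun_prop
      have h := (this.tendsto 0).mono_left (nhdsWithin_le_nhds (s := Set.Ioi 0))
      simpa using h
    obtain ⟨δ, h1, h2, h3⟩ := ((hcont.eventually_lt_const hρ1).and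
      ((eventually_nhdsWithin_of_eventually_nhds (eventually_le_nhds hη0)).and
        self_mem_nhdsWithin)).exists
    exact ⟨δ, h3, h2, h1⟩
  have hN0 : (0 : ℝ) < N := by exact_mod_cast hN
  have hab : -δ ≤ η := by linarith
  set Ω : Set ℂ := Metric.ball 0 1 ∪ Metric.ball 1 ε with hΩ
  have hΩo : IsOpen Ω := Metric.isOpen_ball.union Metric.isOpen_ball
  have hball : ∀ s : ℂ, s.re < 0 → exp s ∈ Metric.ball (0 : ℂ) 1 := fun s hs => by
    rw [mem_ball_zero_iff, norm_exp]
    exact Real.exp_lt_one_iff.2 hs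
  have hkey : ∀ s ∈ keyhole (-δ) η α, exp s ∈ Ω := by
    rintro s (⟨h1, -, -⟩ | ⟨⟨h1, h2⟩, h3⟩ | ⟨h1, h2⟩)
    · exact Or.inl (hball s (by linarith))
    · exact Or.inr (hrect s (abs_le.2 ⟨by linarith, by linarith⟩) h3.le)
    · exact Or.inr (hrect s (abs_le.2 ⟨by linarith, by linarith⟩) h2)
  have hre : ∀ s ∈ keyhole (-δ) η α, -δ ≤ s.re := by
    rintro s (⟨h1, -, -⟩ | ⟨⟨h1, h2⟩, h3⟩ | ⟨h1, h2⟩) <;> linarith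
  obtain ⟨K, hK⟩ := (isCompact_keyhole hab hαπ.le).exists_bound_of_continuousOn
    (f := fun s => Φ (exp s)) (hΦ.continuousOn.comp continuous_exp.continuousOn hkey)
  have hK0 : 0 ≤ K := (norm_nonneg _).trans (hK (η : ℂ) (Or.inr (Or.inr (by simp [hα0.le]))))
  set θ := ρ * Real.exp (N * δ) with hθ
  have hθ0 : 0 < θ := by positivity
  -- `q` is dominated by `θ * |z| ^ N` on the contour
  have hq : ∀ s ∈ keyhole (-δ) η α, ‖q.eval (exp s)‖ ≤ θ * Real.exp (N * s.re) := by
    have h0 : ∀ s : ℂ, -δ ≤ s.re → ρ ≤ θ * Real.exp (N * s.re) := fun s hs => by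
      rw [hθ, mul_assoc, ← Real.exp_add]
      refine le_mul_of_one_le_right hρ0.le (Real.one_le_exp ?_)
      rw [← mul_add]
      exact mul_nonneg hN0.le (by linarith)
    intro s hs
    have hs' := hre s hs
    rcases hs with ⟨h1, h2, h3⟩ | ⟨⟨h1, h2⟩, h3⟩ | ⟨h1, h2⟩
    · exact (hoff s (abs_le.2 ⟨by linarith, by linarith⟩) h2 h3).trans (h0 s hs')
    · exact (hoff s (abs_le.2 ⟨by linarith, by linarith⟩) h3.ge (h3.le.trans hαπ.le)).trans
        (h0 s hs')
    · refine (hon s h1).trans ?_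
      rw [h1, mul_comm η]
      gcongr
      rw [hθ]
      exact le_mul_of_one_le_right hρ0.le (Real.one_le_exp (by positivity))
  have hE2 : Real.exp (N * δ) ^ 2 * θ < 1 := by
    have : Real.exp (N * δ) ^ 2 * θ = Real.exp (3 * N * δ) * ρ := by
      rw [hθ, ← Real.exp_nat_mul, mul_comm ρ, ← mul_assoc, ← Real.exp_add]
      congr 2
      push_cast
      ring
    rwa [this]
  refine ⟨N, q, θ, Real.exp (N * δ), (2 * Real.pi)⁻¹ * ((2 * Real.pi + 2 * (η - -δ)) *
    (K * Real.exp (N * δ))), hN, hqN, hq0, hθ0, Real.one_le_exp (by positivity), hE2, by positivity,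
    fun B m l i j β hBm hml hjN hβ => ?_⟩
  have hβ0 : 0 ≤ β := (norm_nonneg _).trans (hβ 0)
  set n := m + N * i + j with hn
  have hdeg : (B * q ^ i).natDegree ≤ n := by
    refine Polynomial.natDegree_mul_le.trans ?_
    have h1 : (q ^ i).natDegree ≤ N * i :=
      Polynomial.natDegree_pow_le.trans (by rw [mul_comm]; exact Nat.mul_le_mul_right i hqN)
    omega
  have hr1 : Real.exp (-δ) < 1 := Real.exp_lt_one_iff.2 (by linarith)
  rw [coeff_mul_eq_circleIntegral hsum (hΦ.mono Set.subset_union_left) (Real.exp_pos _) hr1 _ hdeg,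
    norm_mul]
  have hpi : ‖(2 * Real.pi * I : ℂ)⁻¹‖ = (2 * Real.pi)⁻¹ := by
    rw [norm_inv, norm_mul, norm_mul, norm_I, mul_one, norm_real, Complex.norm_two,
      Real.norm_of_nonneg Real.pi_pos.le]
  set F : ℂ → ℂ := fun z => (B * q ^ i).eval z * Φ z * (z⁻¹) ^ n with hF
  have hFd : DifferentiableOn ℂ F (Ω \ {0}) := by
    refine ((Polynomial.differentiable _).differentiableOn.mul
      (hΦ.mono Set.sdiff_subset)).mul (DifferentiableOn.pow ?_ n)
    exact differentiableOn_inv.mono fun z hz => hz.2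
  have hbound : ∀ s ∈ keyhole (-δ) η α, ‖F (exp s)‖ ≤
      ((m + 1) * β * Real.exp (N * δ) ^ l) * θ ^ i * (K * Real.exp (N * δ)) := by
    intro s hs
    have hs' := hre s hs
    have e1 : ∀ k : ℕ, ‖exp s‖ ^ k = Real.exp (k * s.re) := fun k => by
      rw [norm_exp, Real.exp_nat_mul]
    have e2 : ‖B.eval (exp s)‖ * Real.exp (-(m * s.re)) ≤ (m + 1) * β * Real.exp (N * δ) ^ l := by
      rw [Polynomial.eval_eq_sum_range' (Nat.lt_succ_of_le hBm)]
      calc ‖∑ k ∈ Finset.range (m + 1), B.coeff k * exp s ^ k‖ * Real.exp (-(m * s.re))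
          ≤ (∑ k ∈ Finset.range (m + 1), β * Real.exp (k * s.re)) * Real.exp (-(m * s.re)) := by
            gcongr
            refine (norm_sum_le _ _).trans (Finset.sum_le_sum fun k _ => ?_)
            rw [norm_mul, norm_pow, e1]
            exact mul_le_mul_of_nonneg_right (hβ k) (Real.exp_pos _).le
        _ ≤ ∑ k ∈ Finset.range (m + 1), β * Real.exp (N * δ) ^ l := by
            rw [Finset.sum_mul]
            refine Finset.sum_le_sum fun k hk => ?_
            rw [mul_assoc, ← Real.exp_add, ← Real.exp_nat_mul]
            refine mul_le_mul_of_nonneg_left (Real.exp_le_exp.2 ?_) hβ0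
            have hk' : (k : ℝ) ≤ m := by
              exact_mod_cast Nat.lt_succ_iff.1 (Finset.mem_range.1 hk)
            have hml' : (m : ℝ) ≤ N * l := by exact_mod_cast hml
            have hk0 : (0 : ℝ) ≤ k := Nat.cast_nonneg k
            nlinarith
        _ = (m + 1) * β * Real.exp (N * δ) ^ l := by
            rw [Finset.sum_const, Finset.card_range, nsmul_eq_mul]
            push_cast
            ring
    have e3 : ‖q.eval (exp s)‖ ^ i * Real.exp (-((N * i : ℕ) * s.re)) ≤ θ ^ i := by
      have h1 : ‖q.eval (exp s)‖ ^ i ≤ (θ * Real.exp (N * s.re)) ^ i := by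
        gcongr
        exact hq s hs
      refine (mul_le_mul_of_nonneg_right h1 (Real.exp_pos _).le).trans_eq ?_
      rw [mul_pow, mul_assoc, ← Real.exp_nat_mul, ← Real.exp_add]
      push_cast
      rw [show (i : ℝ) * (N * s.re) + -(N * i * s.re) = 0 by ring, Real.exp_zero, mul_one]
    have e4 : Real.exp (-(j * s.re)) ≤ Real.exp (N * δ) := by
      refine Real.exp_le_exp.2 ?_
      have hj' : (j : ℝ) ≤ N := by exact_mod_cast hjN
      have hj0 : (0 : ℝ) ≤ j := Nat.cast_nonneg j
      nlinarith
    have e5 : ‖F (exp s)‖ = (‖B.eval (exp s)‖ * Real.exp (-(m * s.re))) *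
        (‖q.eval (exp s)‖ ^ i * Real.exp (-((N * i : ℕ) * s.re))) *
        (‖Φ (exp s)‖ * Real.exp (-(j * s.re))) := by
      have h1 : ‖(exp s)⁻¹ ^ n‖ = Real.exp (-(m * s.re)) * Real.exp (-((N * i : ℕ) * s.re)) *
          Real.exp (-(j * s.re)) := by
        rw [norm_pow, norm_inv, inv_pow, e1, ← Real.exp_neg, ← Real.exp_add, ← Real.exp_add, hn]
        push_cast
        congr 1
        ring
      simp only [hF]
      rw [norm_mul, norm_mul, h1, Polynomial.eval_mul, Polynomial.eval_pow, norm_mul, norm_pow]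
      ring
    rw [e5]
    have hKs := hK s hs
    gcongr
  have hsphere : ContinuousOn F (Metric.sphere 0 (Real.exp (-δ))) := by
    refine hFd.continuousOn.mono fun z hz => ?_
    rw [mem_sphere_zero_iff_norm] at hz
    refine ⟨Or.inl (by rw [mem_ball_zero_iff, hz]; exact hr1), ?_⟩
    rintro (rfl : z = 0)
    rw [norm_zero] at hz
    exact (Real.exp_pos _).ne hz
  have hdiff : DifferentiableOn ℂ (fun s => F (exp s)) (Set.Icc (-δ) η ×ℂ Set.Icc (-α) α) := by
    refine hFd.comp differentiable_exp.differentiableOn fun s hs => ⟨?_, exp_ne_zero s⟩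
    refine Or.inr (hrect s (abs_le.2 ⟨?_, ?_⟩) (abs_le.2 hs.2))
    · linarith [hs.1.1]
    · linarith [hs.1.2]
  have hfinal := norm_circleIntegral_le_of_keyhole hab hα0.le hαπ.le hsphere hdiff hbound
  rw [hpi]
  refine (mul_le_mul_of_nonneg_left hfinal (by positivity)).trans_eq ?_
  ring

end Keyhole

/-! ### Integer power series that continue across a boundary point are rational -/

section Rationality

open Filter

attribute [local instance] Matrix.seminormedAddCommGroup in
/-- Siegel's lemma, in the form of a Padé approximation: for integers `c n` of linear growth there
is a nonzero polynomial `B` of degree less than `2 * M`, with coefficients bounded polynomially in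
`M`, such that the coefficients of `B * ∑ c n X ^ n` at `2 * M, …, 3 * M - 1` vanish. -/
theorem exists_polynomial_mul_coeff_eq_zero (c : ℕ → ℤ) (hc : ∀ n, |c n| ≤ 2 * n) {M : ℕ}
    (hM : 0 < M) :
    ∃ B : Polynomial ℤ, B ≠ 0 ∧ B.natDegree ≤ 2 * M - 1 ∧
      (∀ k, (|B.coeff k| : ℝ) ≤ 12 * (M : ℝ) ^ 2) ∧
      ∀ n, 2 * M ≤ n → n < 3 * M →
        PowerSeries.coeff n ((B : PowerSeries ℤ) * PowerSeries.mk c) = 0 := by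
  set A : Matrix (Fin M) (Fin (2 * M)) ℤ := fun r k => c (2 * M + r - k) with hA
  obtain ⟨b, hb0, hAb, hb⟩ := Int.Matrix.exists_ne_zero_int_vec_norm_le A
    (by simp only [Fintype.card_fin]; omega) (by simpa using hM)
  have hMr : (1 : ℝ) ≤ M := by exact_mod_cast hM
  have hAn : ‖A‖ ≤ 6 * M := by
    rw [Matrix.norm_le_iff (by positivity)]
    intro r k
    rw [Int.norm_eq_abs]
    have h1 := hc (2 * M + r - k)
    have h2 : |c (2 * M + r - k)| ≤ 6 * M := by
      have := r.2
      omega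
    exact_mod_cast h2
  have hbn : ∀ k, (|b k| : ℝ) ≤ 12 * (M : ℝ) ^ 2 := by
    intro k
    have h1 : ‖b k‖ ≤ ‖b‖ := norm_le_pi_norm b k
    rw [Int.norm_eq_abs] at h1
    refine (h1.trans hb).trans ?_
    simp only [Fintype.card_fin]
    have he : ((M : ℝ) / (((2 * M : ℕ) : ℝ) - M)) = 1 := by
      push_cast
      rw [show (2 * M - M : ℝ) = M by ring, div_self (by positivity)]
    rw [he, Real.rpow_one]
    push_cast
    have h2 : max 1 ‖A‖ ≤ 6 * M := max_le (by linarith) hAn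
    nlinarith
  have hcoeff : ∀ k, (∑ i : Fin (2 * M), Polynomial.C (b i) * Polynomial.X ^ (i : ℕ)).coeff k =
      if h : k < 2 * M then b ⟨k, h⟩ else 0 := by
    intro k
    simp only [Polynomial.finsetSum_coeff, Polynomial.coeff_C_mul_X_pow]
    split_ifs with h
    · rw [Finset.sum_eq_single ⟨k, h⟩]
      · simp
      · intro i _ hi
        rw [if_neg]
        rintro rfl
        exact hi rfl
      · simp
    · refine Finset.sum_eq_zero fun i _ => if_neg ?_
      rintro rfl
      exact h i.2
  refine ⟨∑ i : Fin (2 * M), Polynomial.C (b i) * Polynomial.X ^ (i : ℕ), ?_, ?_, ?_, ?_⟩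
  · intro h
    refine hb0 (funext fun i => ?_)
    have := hcoeff i
    rw [h, dif_pos i.2] at this
    simpa using this.symm
  · refine Polynomial.natDegree_sum_le_of_forall_le _ _ fun i _ => ?_
    refine (Polynomial.natDegree_C_mul_X_pow_le _ _).trans ?_
    have := i.2
    omega
  · intro k
    rw [hcoeff]
    split_ifs with h
    · exact hbn _
    · simp only [Int.cast_zero, abs_zero]
      positivity
  · intro n h1 h2
    have h3 := congrFun hAb ⟨n - 2 * M, by omega⟩
    simp only [Matrix.mulVec, dotProduct, hA, Pi.zero_apply] at h3
    rw [← h3, PowerSeries.coeff_mul, Finset.Nat.sum_antidiagonal_eq_sum_range_succ_mk]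
    simp only [Polynomial.coeff_coe, PowerSeries.coeff_mk]
    rw [← Finset.sum_subset (Finset.range_subset_range.2 (show 2 * M ≤ n.succ by omega))
      (fun k _ hk => by
        rw [hcoeff, dif_neg (fun h => hk (Finset.mem_range.2 h)), zero_mul]),
      Finset.sum_range]
    refine Finset.sum_congr rfl fun k _ => ?_
    rw [hcoeff, dif_pos k.2, mul_comm, Fin.eta]
    congr 2
    omega

/-- A case of the Pólya–Carlson theorem: if a power series with integer coefficients of linear
growth continues analytically across a point of the unit circle, then it is rational.

The polynomial `B` of Siegel's lemma makes a stretch of coefficients of `B * ∑ c n X ^ n` vanish. If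
all coefficients of this stretch, up to but not including the one at `n`, are zero, then
multiplication by `q ^ i` does not change the coefficient at `n`, so the bound for
`B * q ^ i` makes it less than `1` in absolute value; being an integer, it is zero. -/
theorem exists_polynomial_mul_eventually_zero (c : ℕ → ℤ) (hc : ∀ n, |c n| ≤ 2 * n)
    {f : ℂ → ℂ} (hsum : ∀ z : ℂ, ‖z‖ < 1 → HasSum (fun n => (c n : ℂ) * z ^ n) (f z))
    (hf : DifferentiableOn ℂ f (Metric.ball 0 1)) {w : ℂ} (hw : ‖w‖ = 1) {ε : ℝ} (hε : 0 < ε)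
    {g : ℂ → ℂ} (hg : DifferentiableOn ℂ g (Metric.ball w ε))
    (hgf : Set.EqOn g f (Metric.ball w ε ∩ Metric.ball 0 1)) :
    ∃ B : Polynomial ℤ, B ≠ 0 ∧ ∃ m, ∀ n, m ≤ n →
      PowerSeries.coeff n ((B : PowerSeries ℤ) * PowerSeries.mk c) = 0 := by
  classical
  -- rotate `w` to `1` and glue the continuation to the function
  set Φ : ℂ → ℂ := fun z => if ‖z‖ < 1 then f (w * z) else g (w * z) with hΦ
  have hwn : ∀ z : ℂ, ‖w * z‖ = ‖z‖ := fun z => by rw [norm_mul, hw, one_mul]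
  have hwd : ∀ z : ℂ, ‖w * z - w‖ = ‖z - 1‖ := fun z => by
    rw [← hwn (z - 1)]
    congr 1
    ring
  have hΦd : DifferentiableOn ℂ Φ (Metric.ball 0 1 ∪ Metric.ball 1 ε) := by
    have hmul : Differentiable ℂ fun z : ℂ => w * z := by fun_prop
    refine DifferentiableOn.union_of_isOpen ?_ ?_ Metric.isOpen_ball Metric.isOpen_ball
    · refine (hf.comp (t := Metric.ball 0 1) (s := Metric.ball 0 1) hmul.differentiableOn
        fun z hz => ?_).congr fun z hz => ?_
      · rw [mem_ball_zero_iff, hwn]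
        exact mem_ball_zero_iff.1 hz
      · exact if_pos (mem_ball_zero_iff.1 hz)
    · have hmem : ∀ z ∈ Metric.ball (1 : ℂ) ε, w * z ∈ Metric.ball w ε := fun z hz => by
        rw [mem_ball_iff_norm, hwd]
        exact mem_ball_iff_norm.1 hz
      refine (hg.comp (s := Metric.ball 1 ε) hmul.differentiableOn hmem).congr fun z hz => ?_
      by_cases h : ‖z‖ < 1
      · simp only [hΦ, if_pos h]
        exact (hgf ⟨hmem z hz, by rwa [mem_ball_zero_iff, hwn]⟩).symm
      · exact if_neg h
  have hΦs : ∀ z : ℂ, ‖z‖ < 1 → HasSum (fun n => ((c n : ℂ) * w ^ n) * z ^ n) (Φ z) := by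
    intro z hz
    simp only [hΦ, if_pos hz]
    have := hsum (w * z) (by rwa [hwn])
    simpa only [mul_pow, mul_assoc] using this
  obtain ⟨N, q, θ, E, C, hN, hqN, hq0, hθ, hE, hEθ, hC, hbound⟩ :=
    exists_coeff_mul_pow_bound hε hΦs hΦd
  have hNpos : 0 < N := hN
  have hκ0 : 0 ≤ E ^ 2 * θ := by positivity
  have hθ1 : θ < 1 := by
    have : 1 * θ ≤ E ^ 2 * θ := by gcongr; exact one_le_pow₀ hE
    linarith
  -- choose the length of the stretch so large that the bound is less than `1`
  obtain ⟨L, hL0, hL⟩ : ∃ L : ℕ, 0 < L ∧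
      24 * C * (N : ℝ) ^ 3 * ((L : ℝ) ^ 3 * (E ^ 2 * θ) ^ L) < 1 := by
    have h1 := (tendsto_pow_const_mul_const_pow_of_abs_lt_one 3
      (by rwa [abs_of_nonneg hκ0] : |E ^ 2 * θ| < 1)).const_mul (24 * C * (N : ℝ) ^ 3)
    rw [mul_zero] at h1
    obtain ⟨L, h2, h3⟩ := ((h1.eventually_lt_const one_pos).and (eventually_gt_atTop 0)).exists
    exact ⟨L, h3, h2⟩
  obtain ⟨B, hB0, hBdeg, hBc, hBz⟩ := exists_polynomial_mul_coeff_eq_zero c hc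
    (Nat.mul_pos hNpos hL0)
  refine ⟨B, hB0, 2 * (N * L), fun n => ?_⟩
  set e : ℕ → ℤ := fun n => PowerSeries.coeff n ((B : PowerSeries ℤ) * PowerSeries.mk c) with he
  change 2 * (N * L) ≤ n → e n = 0
  set B' : Polynomial ℂ := (B.map (Int.castRingHom ℂ)).comp (Polynomial.C w * Polynomial.X) with hB'
  have hB'c : ∀ k, B'.coeff k = (B.coeff k : ℂ) * w ^ k := fun k => by
    rw [hB', Polynomial.comp_C_mul_X_coeff, Polynomial.coeff_map]
    rfl
  have he' : ∀ n, PowerSeries.coeff n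
      ((B' : PowerSeries ℂ) * PowerSeries.mk fun n => (c n : ℂ) * w ^ n) = (e n : ℂ) * w ^ n := by
    intro n
    simp only [he]
    rw [PowerSeries.coeff_mul, PowerSeries.coeff_mul, Int.cast_sum, Finset.sum_mul]
    refine Finset.sum_congr rfl fun p hp => ?_
    rw [Polynomial.coeff_coe, Polynomial.coeff_coe, PowerSeries.coeff_mk, PowerSeries.coeff_mk,
      hB'c, ← Finset.HasAntidiagonal.mem_antidiagonal.1 hp, pow_add]
    push_cast
    ring
  induction n using Nat.strong_induction_on with
  | _ n ih =>
    intro hn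
    by_cases hn3 : n < 3 * (N * L)
    · exact hBz n hn hn3
    have hML : 0 < N * L := Nat.mul_pos hNpos hL0
    set m := 2 * (N * L) - 1 with hm
    set i := (n - 2 * (N * L)) / N with hi
    set j := (n - 2 * (N * L)) % N with hj
    have hij : N * i + j = n - 2 * (N * L) := Nat.div_add_mod _ _
    have hjN : j < N := Nat.mod_lt _ hNpos
    have hiL : L ≤ i := by
      rw [hi, Nat.le_div_iff_mul_le hNpos, mul_comm]
      omega
    have hnm : n = m + N * i + (j + 1) := by omega
    have h1 : PowerSeries.coeff n (((B' * q ^ i : Polynomial ℂ) : PowerSeries ℂ) *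
        PowerSeries.mk fun n => (c n : ℂ) * w ^ n) = (e n : ℂ) * w ^ n := by
      rw [Polynomial.coe_mul, mul_comm (B' : PowerSeries ℂ), mul_assoc, PowerSeries.coeff_mul,
        Finset.Nat.sum_antidiagonal_eq_sum_range_succ_mk, Finset.sum_eq_single 0]
      · rw [he', Polynomial.coeff_coe, Polynomial.coeff_zero_eq_eval_zero, Polynomial.eval_pow,
          ← Polynomial.coeff_zero_eq_eval_zero, hq0, one_pow, one_mul, Nat.sub_zero]
      · intro k hk hk0
        simp only
        rw [he', Polynomial.coeff_coe]
        by_cases hkN : k ≤ N * i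
        · rw [ih (n - k) (by have := Finset.mem_range.1 hk; omega) (by omega)]
          simp
        · rw [Polynomial.coeff_eq_zero_of_natDegree_lt, zero_mul]
          refine (Polynomial.natDegree_pow_le.trans ?_).trans_lt (not_le.1 hkN)
          rw [mul_comm]
          exact Nat.mul_le_mul_right i hqN
      · simp
    have h2 := hbound B' m (2 * L) i (j + 1) (12 * ((N * L : ℕ) : ℝ) ^ 2) (by
        refine Polynomial.natDegree_comp_le.trans ?_
        have h3 : (Polynomial.C w * Polynomial.X).natDegree ≤ 1 :=
          (Polynomial.natDegree_C_mul_le w _).trans Polynomial.natDegree_X_le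
        have h4 : (B.map (Int.castRingHom ℂ)).natDegree ≤ m :=
          Polynomial.natDegree_map_le.trans hBdeg
        calc _ ≤ m * 1 := Nat.mul_le_mul h4 h3
          _ = m := mul_one m)
      (by rw [mul_left_comm N 2 L]; omega) hjN (fun k => by
        rw [hB'c, norm_mul, norm_pow, hw, one_pow, mul_one, Complex.norm_intCast]
        exact hBc k)
    rw [← hnm, h1, norm_mul, norm_pow, hw, one_pow, mul_one, Complex.norm_intCast] at h2
    have h3 : E ^ (2 * L) * θ ^ i ≤ (E ^ 2 * θ) ^ L := by
      rw [mul_pow, ← pow_mul]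
      exact mul_le_mul_of_nonneg_left (pow_le_pow_of_le_one hθ.le hθ1.le hiL) (by positivity)
    have h4 : ((m : ℝ) + 1) = 2 * (N * L) := by
      have : m + 1 = 2 * (N * L) := by omega
      exact_mod_cast this
    have h5 : |(e n : ℝ)| < 1 := by
      refine (h2.trans (mul_le_mul_of_nonneg_left h3 (by positivity))).trans_lt ?_
      refine lt_of_eq_of_lt ?_ hL
      rw [h4]
      push_cast
      ring
    have h6 : |e n| < 1 := by exact_mod_cast h5
    exact Int.abs_lt_one_iff.1 h6

/-- Modulo a prime not dividing the lowest coefficient of `B`, the recurrence determines each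
coefficient from its predecessors, so by the pigeonhole principle the sequence is eventually
periodic. -/
theorem exists_prime_eventually_periodic {c : ℕ → ℤ} {B : Polynomial ℤ} (hB : B ≠ 0) {m : ℕ}
    (h : ∀ n, m ≤ n → PowerSeries.coeff n ((B : PowerSeries ℤ) * PowerSeries.mk c) = 0) :
    ∃ ℓ : ℕ, ℓ.Prime ∧ ∃ t > 0, ∃ n₀, ∀ n, n₀ ≤ n → ∀ k : ℕ,
      (c (n + t * k) : ZMod ℓ) = c n := by
  set s := B.natTrailingDegree with hs
  set d := B.natDegree with hd
  have hbs : B.coeff s ≠ 0 := by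
    rw [hs, ← Polynomial.trailingCoeff]
    exact Polynomial.trailingCoeff_nonzero_iff_nonzero.2 hB
  obtain ⟨ℓ, hℓ, hℓp⟩ := Nat.exists_infinite_primes ((B.coeff s).natAbs + 1)
  have := Fact.mk hℓp
  refine ⟨ℓ, hℓp, ?_⟩
  have hunit : (B.coeff s : ZMod ℓ) ≠ 0 := by
    rw [Ne, ZMod.intCast_zmod_eq_zero_iff_dvd]
    intro hdvd
    have := Nat.le_of_dvd (Int.natAbs_pos.2 hbs) (Int.natCast_dvd.1 hdvd)
    omega
  -- two states of length `d` that agree produce the same next value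
  have hstep : ∀ x y : ℕ, m ≤ x → m ≤ y → (∀ i < d, (c (x + i) : ZMod ℓ) = c (y + i)) →
      (c (x + d) : ZMod ℓ) = c (y + d) := by
    intro x y hx hy hxy
    have hsd : s ≤ d := Polynomial.natTrailingDegree_le_natDegree B
    have hsum : ∀ x, m ≤ x → (B.coeff s : ZMod ℓ) * c (x + d) +
        ∑ k ∈ Finset.Ioc s d, (B.coeff k : ZMod ℓ) * c (x + d + s - k) = 0 := by
      intro x hx
      have h1 := h (x + d + s) (by omega)
      rw [PowerSeries.coeff_mul, Finset.Nat.sum_antidiagonal_eq_sum_range_succ_mk] at h1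
      simp only [Polynomial.coeff_coe, PowerSeries.coeff_mk] at h1
      have hsub : Finset.Icc s d ⊆ Finset.range (x + d + s).succ := fun k hk => by
        have := Finset.mem_Icc.1 hk
        exact Finset.mem_range.2 (by omega)
      rw [← Finset.sum_subset hsub (fun k _ hk => by
        rcases lt_or_ge k s with hks | hks
        · rw [Polynomial.coeff_eq_zero_of_lt_natTrailingDegree hks, zero_mul]
        · rw [Polynomial.coeff_eq_zero_of_natDegree_lt, zero_mul]
          by_contra hcon
          exact hk (Finset.mem_Icc.2 ⟨hks, not_lt.1 hcon⟩)),
        ← Finset.Ioc_insert_left hsd, Finset.sum_insert (by simp)] at h1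
      have h2 := congrArg (Int.cast : ℤ → ZMod ℓ) h1
      push_cast at h2
      rwa [Nat.add_sub_cancel] at h2
    have hx1 := hsum x hx
    have hy1 := hsum y hy
    have heq : ∑ k ∈ Finset.Ioc s d, (B.coeff k : ZMod ℓ) * c (x + d + s - k) =
        ∑ k ∈ Finset.Ioc s d, (B.coeff k : ZMod ℓ) * c (y + d + s - k) := by
      refine Finset.sum_congr rfl fun k hk => ?_
      have hk' := Finset.mem_Ioc.1 hk
      have := hxy (d + s - k) (by omega)
      rw [show x + d + s - k = x + (d + s - k) by omega,
        show y + d + s - k = y + (d + s - k) by omega, this]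
    rw [heq] at hx1
    exact mul_left_cancel₀ hunit (add_right_cancel (hx1.trans hy1.symm))
  obtain ⟨u, v, huv, hst⟩ := Finite.exists_ne_map_eq_of_infinite
    (fun x : ℕ => fun i : Fin d => (c (m + x + i) : ZMod ℓ))
  wlog hlt : u < v generalizing u v
  · exact this v u huv.symm hst.symm (lt_of_le_of_ne (not_lt.1 hlt) huv.symm)
  have hper : ∀ i, (c (m + u + i) : ZMod ℓ) = c (m + v + i) := by
    intro i
    induction i using Nat.strong_induction_on with
    | _ i ih =>
      by_cases hi : i < d
      · exact congrFun hst ⟨i, hi⟩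
      · have h1 := hstep (m + u + (i - d)) (m + v + (i - d)) (by omega) (by omega) fun r hr => by
          have := ih (i - d + r) (by omega)
          rwa [← add_assoc, ← add_assoc] at this
        rwa [add_assoc, add_assoc (m + v), Nat.sub_add_cancel (not_lt.1 hi)] at h1
  refine ⟨v - u, by omega, m + u, fun n hn k => ?_⟩
  induction k with
  | zero => simp
  | succ k ih =>
    have h1 := hper (n + (v - u) * k - (m + u))
    rw [show m + u + (n + (v - u) * k - (m + u)) = n + (v - u) * k by omega] at h1
    rw [← ih, h1]
    congr 2
    rw [mul_add]
    omega

end Rationality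

/-- The generating function of the auxiliary sequence has the unit circle as a natural boundary: if
not, then modulo some prime `ℓ` the sequence would have an eventual period `t`, but for a large
prime `p ≡ 1` modulo `t * ℓ` the values at `p` and at `p ^ 2 ≡ p` are `0` and `p ^ 2 ≡ 1`. -/
theorem IsAuxSeq.not_continuation {c : ℕ → ℕ} (h : IsAuxSeq c) {f : ℂ → ℂ}
    (hsum : ∀ z : ℂ, ‖z‖ < 1 → HasSum (fun n => (c n : ℂ) * z ^ n) (f z))
    (hf : DifferentiableOn ℂ f (Metric.ball 0 1)) {w : ℂ} (hw : ‖w‖ = 1) {ε : ℝ} (hε : 0 < ε)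
    {g : ℂ → ℂ} (hg : DifferentiableOn ℂ g (Metric.ball w ε)) :
    ¬ Set.EqOn g f (Metric.ball w ε ∩ Metric.ball 0 1) := by
  intro hgf
  obtain ⟨B, hB, m, hm⟩ := exists_polynomial_mul_eventually_zero (fun n => (c n : ℤ))
    (fun n => by
      rw [abs_of_nonneg (by positivity)]
      exact_mod_cast h.le_two_mul n)
    (by simpa using hsum) hf hw hε hg hgf
  obtain ⟨ℓ, hℓ, t, ht, n₀, hper⟩ := exists_prime_eventually_periodic hB hm
  have := Fact.mk hℓ
  obtain ⟨p, hp, hpn, hpm⟩ := Nat.exists_prime_gt_modEq_one (k := t * ℓ) n₀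
    (Nat.mul_pos ht hℓ.pos).ne'
  have h1 : t ∣ p - 1 := (dvd_mul_right t ℓ).trans ((Nat.modEq_iff_dvd' hp.one_le).1 hpm.symm)
  obtain ⟨k, hk⟩ := h1
  have h2 : p ^ 2 = p + t * (p * k) := by
    have : p = 1 + t * k := by have := hp.one_le; omega
    calc p ^ 2 = p * (1 + t * k) := by rw [← this, pow_two]
      _ = p + t * (p * k) := by ring
  have h3 := hper p hpn.le (p * k)
  have h4 : ((p : ℕ) : ZMod ℓ) = 1 := by
    have := (ZMod.natCast_eq_natCast_iff p 1 ℓ).2 (hpm.of_dvd (dvd_mul_left ℓ t))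
    simpa using this
  rw [← h2, h.prime_sq hp, h.prime p hp] at h3
  push_cast at h3
  rw [h4] at h3
  simp at h3

/-! ### The zeta functions -/

section Zeta

open Filter Topology

theorem summable_two_mul_add_one_mul_geometric {r : ℝ} (hr0 : 0 ≤ r) (hr : r < 1) :
    Summable fun n : ℕ => (2 * (n : ℝ) + 1) * r ^ n := by
  have hr' : ‖r‖ < 1 := by rwa [Real.norm_of_nonneg hr0]
  have h1 := (summable_pow_mul_geometric_of_norm_lt_one 1 hr').mul_left 2
  have h2 := summable_geometric_of_norm_lt_one hr'
  refine (h1.add h2).congr fun n => ?_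
  ring

theorem summable_and_differentiableOn_of_le {c : ℕ → ℕ} (hc : ∀ n, c n ≤ 2 * n) :
    (∀ z : ℂ, ‖z‖ < 1 → Summable fun n : ℕ => (c n : ℂ) * z ^ n) ∧
      DifferentiableOn ℂ (fun z : ℂ => ∑' n : ℕ, (c n : ℂ) * z ^ n) (Metric.ball 0 1) := by
  have hle : ∀ (n : ℕ) (z : ℂ) (r : ℝ), ‖z‖ ≤ r →
      ‖(c n : ℂ) * z ^ n‖ ≤ (2 * (n : ℝ) + 1) * r ^ n := by
    intro n z r hz
    rw [norm_mul, norm_pow, Complex.norm_natCast]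
    have h1 : (c n : ℝ) ≤ 2 * n := by exact_mod_cast hc n
    have hr : 0 ≤ r := (norm_nonneg z).trans hz
    gcongr
    linarith
  refine ⟨fun z hz => Summable.of_norm_bounded
    (summable_two_mul_add_one_mul_geometric (norm_nonneg z) hz) fun n => hle n z _ le_rfl, ?_⟩
  intro z hz
  obtain ⟨r, hr, hr1⟩ := exists_between (mem_ball_zero_iff.1 hz)
  have h1 := Complex.differentiableOn_tsum_of_summable_norm
    (F := fun (n : ℕ) (z : ℂ) => (c n : ℂ) * z ^ n) (U := Metric.ball 0 r)
    (summable_two_mul_add_one_mul_geometric ((norm_nonneg z).trans hr.le) hr1)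
    (fun n => by fun_prop) Metric.isOpen_ball
    (fun n w hw => hle n w r (mem_ball_zero_iff.1 hw).le)
  exact (h1.differentiableAt (Metric.isOpen_ball.mem_nhds
    (mem_ball_zero_iff.2 hr))).differentiableWithinAt

/-- The series `∑ u n z ^ n / n` can be differentiated term by term. -/
theorem summable_and_exists_hasDerivAt {u : ℕ → ℂ}
    (hu : ∀ n : ℕ, n ≠ 0 → ‖u n‖ ≤ (2 * (n : ℝ) + 1) * 2 ^ n) {z : ℂ} (hz : ‖z‖ < 1 / 2) :
    Summable (fun n : ℕ => u n * z ^ n / (n : ℂ)) ∧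
      ∃ D : ℂ, HasDerivAt (fun w => ∑' n : ℕ, u n * w ^ n / (n : ℂ)) D z ∧
        HasSum (fun n : ℕ => if n = 0 then 0 else u n * z ^ n) (z * D) := by
  obtain ⟨r, hr, hr1⟩ := exists_between hz
  have hr0 : 0 ≤ r := (norm_nonneg z).trans hr.le
  have hsum := summable_two_mul_add_one_mul_geometric (r := 2 * r) (by positivity) (by linarith)
  have hle : ∀ (n : ℕ) (w : ℂ), w ∈ Metric.ball (0 : ℂ) r →
      ‖u n * w ^ n / (n : ℂ)‖ ≤ (2 * (n : ℝ) + 1) * (2 * r) ^ n := by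
    intro n w hw
    rcases eq_or_ne n 0 with rfl | hn
    · simp
    have hw' := (mem_ball_zero_iff.1 hw).le
    rw [norm_div, norm_mul, norm_pow, Complex.norm_natCast, mul_pow, ← mul_assoc]
    refine (div_le_self (by positivity) (by exact_mod_cast Nat.one_le_iff_ne_zero.2 hn)).trans ?_
    have := hu n hn
    gcongr
  have hdiff : ∀ n : ℕ, DifferentiableOn ℂ (fun w : ℂ => u n * w ^ n / (n : ℂ))
      (Metric.ball 0 r) := fun n => by fun_prop
  have hzr : z ∈ Metric.ball (0 : ℂ) r := mem_ball_zero_iff.2 hr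
  have h1 := Complex.differentiableOn_tsum_of_summable_norm hsum hdiff Metric.isOpen_ball hle
  have h2 := Complex.hasSum_deriv_of_summable_norm hsum hdiff Metric.isOpen_ball hle hzr
  refine ⟨Summable.of_norm_bounded hsum fun n => hle n z hzr, _,
    (h1.differentiableAt (Metric.isOpen_ball.mem_nhds hzr)).hasDerivAt, ?_⟩
  refine (h2.mul_left z).congr_fun ?_
  intro n
  rcases eq_or_ne n 0 with rfl | hn
  · simp
  have hd : HasDerivAt (fun w : ℂ => u n * w ^ n / (n : ℂ))
      (u n * ((n : ℂ) * z ^ (n - 1)) / (n : ℂ)) z :=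
    ((hasDerivAt_pow n z).const_mul (u n)).div_const _
  rw [hd.deriv, if_neg hn]
  obtain ⟨k, rfl⟩ := Nat.exists_eq_succ_of_ne_zero hn
  have : ((k.succ : ℕ) : ℂ) ≠ 0 := by exact_mod_cast hn
  rw [Nat.succ_sub_one, pow_succ]
  field_simp

theorem dynZeta_eq_of_periodCount_eq_two_pow {X : Type*} {T : X → X}
    (hT : ∀ n, n ≠ 0 → periodCount T n = 2 ^ n) {z : ℂ} (hz : ‖z‖ < 1 / 2) :
    Summable (fun n : ℕ => (periodCount T n : ℂ) * z ^ n / (n : ℂ)) ∧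
      dynZeta T z = 1 / (1 - 2 * z) := by
  have h2 : ‖2 * z‖ < 1 := by
    rw [norm_mul, Complex.norm_two]
    linarith
  have h1 : HasSum (fun n : ℕ => (periodCount T n : ℂ) * z ^ n / (n : ℂ))
      (-Complex.log (1 - 2 * z)) := by
    refine (Complex.hasSum_taylorSeries_neg_log h2).congr_fun ?_
    intro n
    rcases eq_or_ne n 0 with rfl | hn
    · simp
    · rw [hT n hn, mul_pow]
      push_cast
      rfl
  refine ⟨h1.summable, ?_⟩
  rw [dynZeta, h1.tsum_eq, Complex.exp_neg, Complex.exp_log, one_div]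
  intro h
  rw [← sub_eq_zero.1 h, norm_one] at h2
  exact lt_irrefl _ h2

theorem dynZeta_of_periodCount_eq {X : Type*} {T : X → X} {c : ℕ → ℕ} (hc : ∀ n, c n ≤ 2 * n)
    (hT : ∀ n, n ≠ 0 → periodCount T n = 2 ^ n + c n * 2 ^ n) {z : ℂ} (hz : ‖z‖ < 1 / 2) :
    Summable (fun n : ℕ => (periodCount T n : ℂ) * z ^ n / (n : ℂ)) ∧
      Summable (fun n : ℕ => (c n : ℂ) * 2 ^ n * z ^ n) ∧
      DifferentiableAt ℂ (dynZeta T) z ∧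
      z * deriv (dynZeta T) z / dynZeta T z =
        2 * z / (1 - 2 * z) + ∑' n : ℕ, (c n : ℂ) * 2 ^ n * z ^ n := by
  have h2 : ‖2 * z‖ < 1 := by
    rw [norm_mul, Complex.norm_two]
    linarith
  have hu : ∀ n : ℕ, n ≠ 0 → ‖(periodCount T n : ℂ)‖ ≤ (2 * (n : ℝ) + 1) * 2 ^ n := by
    intro n hn
    rw [Complex.norm_natCast, hT n hn]
    push_cast
    have h3 : (c n : ℝ) ≤ 2 * n := by exact_mod_cast hc n
    have h4 : (c n : ℝ) * 2 ^ n ≤ 2 * n * 2 ^ n := by gcongr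
    linarith
  obtain ⟨h3, D, hD, hDs⟩ := summable_and_exists_hasDerivAt hu hz
  have h4 : Summable (fun n : ℕ => (c n : ℂ) * 2 ^ n * z ^ n) := by
    simpa only [mul_pow, mul_assoc] using (summable_and_differentiableOn_of_le hc).1 _ h2
  have hexp : HasDerivAt (dynZeta T) (dynZeta T z * D) z := hD.cexp
  refine ⟨h3, h4, hexp.differentiableAt, ?_⟩
  rw [hexp.deriv]
  have hne : dynZeta T z ≠ 0 := Complex.exp_ne_zero _
  have h5 : z * (dynZeta T z * D) / dynZeta T z = z * D := by field_simp
  have h6 : HasSum (fun n : ℕ => if n = 0 then 0 else (2 * z) ^ n) (2 * z / (1 - 2 * z)) := by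
    have h7 := (hasSum_geometric_of_norm_lt_one h2).mul_left (2 * z)
    rw [← hasSum_nat_add_iff' 1]
    simpa [pow_succ', div_eq_mul_inv] using h7
  have hc0 : c 0 = 0 := Nat.le_zero.1 (hc 0)
  rw [h5]
  refine hDs.unique ((h6.add h4.hasSum).congr_fun ?_)
  intro n
  rcases eq_or_ne n 0 with rfl | hn
  · simp [hc0]
  · rw [if_neg hn, if_neg hn, hT n hn, mul_pow]
    push_cast
    ring

/-- The logarithmic derivative carries a continuation of `Z` across a point of the circle
`|z| = 1 / 2` to a continuation of `f` across a nearby point of the unit circle. The point has to be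
moved to avoid the pole at `1 / 2` and the possible zeros of the continuation of `Z`. -/
theorem hasNaturalBoundary_of_logDeriv {Z f : ℂ → ℂ}
    (hZ : DifferentiableOn ℂ Z (Metric.ball 0 (1 / 2)))
    (hZ0 : ∀ z ∈ Metric.ball (0 : ℂ) (1 / 2), Z z ≠ 0)
    (hf : ∀ z ∈ Metric.ball (0 : ℂ) (1 / 2),
      z * deriv Z z / Z z = 2 * z / (1 - 2 * z) + f (2 * z))
    (hnat : ∀ w : ℂ, ‖w‖ = 1 → ∀ ε > 0, ∀ g : ℂ → ℂ, DifferentiableOn ℂ g (Metric.ball w ε) →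
      ¬ Set.EqOn g f (Metric.ball w ε ∩ Metric.ball 0 1)) :
    HasNaturalBoundary Z (1 / 2) := by
  refine ⟨by norm_num, hZ, ?_⟩
  rintro w hw ⟨U, hU, hwU, G, hG, hGZ⟩
  have hwn : ‖w‖ = 1 / 2 := mem_sphere_zero_iff_norm.1 hw
  have hw0 : w ≠ 0 := by
    rintro rfl
    norm_num at hwn
  have hGne : ∀ᶠ z in 𝓝[≠] w, G z ≠ 0 := by
    refine (hG.analyticAt (hU.mem_nhds hwU)).eventually_eq_zero_or_eventually_ne_zero.resolve_left
      fun h => ?_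
    have htend : Tendsto (fun t : ℝ => (1 - t : ℂ) * w) (𝓝[>] 0) (𝓝 w) := by
      have : Continuous fun t : ℝ => (1 - t : ℂ) * w := by fun_prop
      simpa using (this.tendsto 0).mono_left (nhdsWithin_le_nhds (s := Set.Ioi 0))
    obtain ⟨t, ⟨h1, h2⟩, h3, h4⟩ := ((htend.eventually (h.and (hU.mem_nhds hwU))).and
      (Ioo_mem_nhdsGT (one_pos : (0 : ℝ) < 1))).exists
    have h5 : (1 - t : ℂ) * w ∈ Metric.ball (0 : ℂ) (1 / 2) := by
      rw [mem_ball_zero_iff, norm_mul, hwn, show (1 - t : ℂ) = ((1 - t : ℝ) : ℂ) by push_cast; rfl,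
        Complex.norm_of_nonneg (by linarith)]
      linarith
    exact hZ0 _ h5 ((hGZ ⟨h2, h5⟩).symm.trans h1)
  have hhalf : ∀ᶠ z in 𝓝[≠] w, z ≠ 1 / 2 := by
    rcases eq_or_ne w (1 / 2) with h | h
    · rw [h]
      exact self_mem_nhdsWithin
    · exact eventually_nhdsWithin_of_eventually_nhds (eventually_ne_nhds h)
  have hcirc : Tendsto (fun t : ℝ => w * Complex.exp (t * Complex.I)) (𝓝[>] 0) (𝓝[≠] w) := by
    refine tendsto_nhdsWithin_iff.2 ⟨?_, ?_⟩
    · have : Continuous fun t : ℝ => w * Complex.exp (t * Complex.I) := by fun_prop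
      simpa using (this.tendsto 0).mono_left (nhdsWithin_le_nhds (s := Set.Ioi 0))
    · filter_upwards [Ioo_mem_nhdsGT (one_pos : (0 : ℝ) < 1)] with t ht h
      have h1 : Complex.exp (t * Complex.I) = 1 := mul_left_cancel₀ hw0 (h.trans (mul_one w).symm)
      have h2 := congrArg Complex.im h1
      rw [Complex.exp_ofReal_mul_I_im, Complex.one_im] at h2
      exact (Real.sin_pos_of_pos_of_lt_pi ht.1 (by linarith [ht.2, Real.pi_gt_three])).ne' h2
  obtain ⟨t, ⟨h1, h2⟩, h3⟩ := (hcirc.eventually ((hGne.and hhalf).and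
    (eventually_nhdsWithin_of_eventually_nhds (hU.mem_nhds hwU)))).exists
  set v := w * Complex.exp (t * Complex.I) with hv
  have hvn : ‖v‖ = 1 / 2 := by rw [hv, norm_mul, hwn, Complex.norm_exp_ofReal_mul_I, mul_one]
  have hGv : ∀ᶠ z in 𝓝 v, G z ≠ 0 :=
    (hG.continuousOn.continuousAt (hU.mem_nhds h3)).eventually_ne h1
  obtain ⟨ε, hε, hball⟩ := Metric.eventually_nhds_iff.1
    (hGv.and ((eventually_ne_nhds h2).and (hU.mem_nhds h3)))
  have hscale : ∀ u ∈ Metric.ball (2 * v) (2 * ε), dist (u / 2) v < ε := by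
    intro u hu
    rw [mem_ball_iff_norm] at hu
    rw [dist_eq_norm, show u / 2 - v = (u - 2 * v) / 2 by ring, norm_div, Complex.norm_two]
    linarith
  refine hnat (2 * v) (by rw [norm_mul, Complex.norm_two, hvn]; norm_num) (2 * ε) (by positivity)
    (fun u => u / 2 * deriv G (u / 2) / G (u / 2) - u / (1 - u)) ?_ ?_
  · intro u hu
    obtain ⟨k1, k2, k3⟩ := hball (hscale u hu)
    have hu1 : 1 - u ≠ 0 := fun h => k2 (by rw [← sub_eq_zero.1 h])
    have hdiv : DifferentiableAt ℂ (fun u : ℂ => u / 2) u := by fun_prop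
    have d1 : DifferentiableAt ℂ (fun u => G (u / 2)) u :=
      (hG.differentiableAt (hU.mem_nhds k3)).comp (f := fun u : ℂ => u / 2) u hdiv
    have d2 : DifferentiableAt ℂ (fun u => deriv G (u / 2)) u :=
      ((hG.deriv hU).differentiableAt (hU.mem_nhds k3)).comp (f := fun u : ℂ => u / 2) u hdiv
    have d3 : DifferentiableAt ℂ (fun u : ℂ => u / (1 - u)) u :=
      differentiableAt_id.div (by fun_prop) hu1
    exact (((hdiv.mul d2).div d1 k1).sub d3).differentiableWithinAt
  · rintro u ⟨hu, hu1⟩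
    obtain ⟨k1, k2, k3⟩ := hball (hscale u hu)
    have hub : u / 2 ∈ Metric.ball (0 : ℂ) (1 / 2) := by
      rw [mem_ball_zero_iff] at hu1 ⊢
      rw [norm_div, Complex.norm_two]
      linarith
    have hev : G =ᶠ[𝓝 (u / 2)] Z :=
      hGZ.eventuallyEq_of_mem ((hU.inter Metric.isOpen_ball).mem_nhds ⟨k3, hub⟩)
    have h4 := hf _ hub
    rw [mul_div_cancel₀ u (two_ne_zero : (2 : ℂ) ≠ 0)] at h4
    simp only
    rw [hev.deriv_eq, hev.eq_of_nhds, h4]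
    ring

/-- A function with natural boundary `|z| = R` has a power series at `0` whose radius of convergence
is exactly `R`: a larger radius would give a continuation across every point of the circle. -/
theorem HasNaturalBoundary.exists_hasFPowerSeriesOnBall {Z : ℂ → ℂ} {R : NNReal}
    (h : HasNaturalBoundary Z R) :
    ∃ p : FormalMultilinearSeries ℂ ℂ ℂ, HasFPowerSeriesOnBall Z p 0 R ∧ p.radius = R := by
  obtain ⟨hR, hZ, hnat⟩ := h
  have hR' : 0 < R := by exact_mod_cast hR
  have hr : ∀ r : NNReal, 0 < r → r < R →
      HasFPowerSeriesOnBall Z (cauchyPowerSeries Z 0 r) 0 r := fun r hr0 hr1 =>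
    (hZ.mono (Metric.closedBall_subset_ball (by exact_mod_cast hr1))).hasFPowerSeriesOnBall hr0
  obtain ⟨r₀, hr₀, hr₀R⟩ := exists_between hR'
  have hp : ∀ r : NNReal, 0 < r → r < R →
      HasFPowerSeriesOnBall Z (cauchyPowerSeries Z 0 r₀) 0 r := fun r hr0 hr1 => by
    rw [(hr r₀ hr₀ hr₀R).hasFPowerSeriesAt.eq_formalMultilinearSeries
      (hr r hr0 hr1).hasFPowerSeriesAt]
    exact hr r hr0 hr1
  set p := cauchyPowerSeries Z 0 r₀ with hpdef
  have hball : HasFPowerSeriesOnBall Z p 0 R := by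
    refine ⟨?_, by exact_mod_cast hR', fun {y} hy => ?_⟩
    · refine ENNReal.le_of_forall_nnreal_lt fun r hrR => ?_
      rcases eq_or_ne r 0 with rfl | h0
      · simp
      · exact (hp r (pos_iff_ne_zero.2 h0) (by exact_mod_cast hrR)).r_le
    · have hy' : ‖y‖₊ < R := by
        rw [Metric.mem_eball, edist_zero_right] at hy
        exact_mod_cast hy
      obtain ⟨r, hyr, hrR⟩ := exists_between hy'
      refine (hp r (pos_of_gt hyr) hrR).hasSum ?_
      rw [Metric.mem_eball, edist_zero_right]
      exact_mod_cast hyr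
  refine ⟨p, hball, le_antisymm ?_ hball.r_le⟩
  by_contra hcon
  have hlt : (R : ENNReal) < p.radius := not_le.1 hcon
  have hsum := p.hasFPowerSeriesOnBall (pos_of_gt hlt)
  refine hnat (R : ℂ) (by simp) ⟨Metric.eball 0 p.radius, Metric.isOpen_eball, ?_, p.sum,
    hsum.differentiableOn, ?_⟩
  · rw [Metric.mem_eball, edist_zero_right]
    simpa [enorm] using hlt
  · rintro y ⟨-, hy⟩
    have := hball.sum (y := y) (by
      rw [Metric.mem_eball, edist_zero_right]
      rw [mem_ball_zero_iff] at hy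
      exact_mod_cast hy)
    rw [zero_add] at this
    exact this.symm

end Zeta

/-! ### Realizing the prescribed orbit counts -/

theorem IsTopDynSystem.periodCount_eq {X : Type*} [TopologicalSpace X] {T : X ≃ₜ X}
    (h : IsTopDynSystem T) {o : ℕ → ℕ} {u : ℕ → ℤ}
    (ho : ∀ n, n ≠ 0 → orbitCount T n = o n)
    (hu : ∀ n, n ≠ 0 → (n * o n : ℤ) = moebiusTransform u n) {n : ℕ} (hn : n ≠ 0) :
    (periodCount T n : ℤ) = u n := by
  rw [periodCount_eq_sum_divisors h.finite_period (Nat.one_le_iff_ne_zero.2 hn),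
    ← sum_divisors_moebiusTransform u (Nat.pos_of_ne_zero hn)]
  push_cast
  refine Finset.sum_congr rfl fun d hd => ?_
  have hd0 : d ≠ 0 := (Nat.pos_of_mem_divisors hd).ne'
  rw [ho d hd0, hu d hd0]

theorem mainTheorem8 :
    (∃! c : ℕ → ℕ, IsAuxSeq c) ∧
    ∀ c : ℕ → ℕ, IsAuxSeq c →
      ∃ a b : ℕ → ℕ,
        (∀ n : ℕ, 1 ≤ n →
          (a n : ℚ) = 1 / (n : ℚ) *
            ∑ d ∈ n.divisors, (ArithmeticFunction.moebius (n / d) : ℚ) * 2 ^ d ∧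
          (b n : ℚ) = (a n : ℚ) + 1 / (n : ℚ) *
            ∑ d ∈ n.divisors, (ArithmeticFunction.moebius (n / d) : ℚ) * (c d : ℚ) * 2 ^ d) ∧
        ∃ (X : Type) (_ : MetricSpace X) (H : HalvingData X),
          IsTopDynSystem H.T ∧ IsTopDynSystem H.halvedMap ∧
          (∀ n : ℕ, 1 ≤ n → orbitCount H.T n = a n ∧ orbitCount H.halvedMap n = b n) ∧
          (∀ z : ℂ, ‖z‖ < 1 / 2 →
            Summable (fun n : ℕ => (periodCount H.T n : ℂ) * z ^ n / (n : ℂ)) ∧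
            dynZeta H.T z = 1 / (1 - 2 * z)) ∧
          (∀ z : ℂ, ‖z‖ < 1 / 2 →
            Summable (fun n : ℕ => (periodCount H.halvedMap n : ℂ) * z ^ n / (n : ℂ)) ∧
            Summable (fun n : ℕ => (c n : ℂ) * 2 ^ n * z ^ n) ∧
            z * deriv (dynZeta H.halvedMap) z / dynZeta H.halvedMap z =
              2 * z / (1 - 2 * z) + ∑' n : ℕ, (c n : ℂ) * 2 ^ n * z ^ n) ∧
          (∃ p : FormalMultilinearSeries ℂ ℂ ℂ,
            HasFPowerSeriesOnBall (dynZeta H.halvedMap) p 0 (1 / 2) ∧ p.radius = 1 / 2) ∧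
          HasNaturalBoundary (dynZeta H.halvedMap) (1 / 2) := by
  refine ⟨existsUnique_isAuxSeq, fun c hc => ?_⟩
  obtain ⟨a, b, e, ha, hb, ha1, he1, hea, heo, hbe⟩ := hc.exists_orbit_numbers
  refine ⟨a, b, fun n hn => ?_, ?_⟩
  · have hn0 : n ≠ 0 := by omega
    have hq : (n : ℚ) ≠ 0 := by exact_mod_cast hn0
    have h1 : (n : ℚ) * a n =
        ∑ d ∈ n.divisors, (ArithmeticFunction.moebius (n / d) : ℚ) * 2 ^ d := by
      have := congrArg (Int.cast : ℤ → ℚ) (ha n hn0)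
      rw [moebiusTransform] at this
      exact_mod_cast this
    have h2 : (n : ℚ) * b n = n * a n +
        ∑ d ∈ n.divisors, (ArithmeticFunction.moebius (n / d) : ℚ) * (c d : ℚ) * 2 ^ d := by
      have := congrArg (Int.cast : ℤ → ℚ) (hb n hn0)
      rw [← ha n hn0, moebiusTransform] at this
      simp only [mul_assoc]
      exact_mod_cast this
    rw [← h1]
    refine ⟨by field_simp, ?_⟩
    rw [← sub_eq_iff_eq_add'.2 h2]
    field_simp
    ring
  -- the fixed point at infinity is one of the `a 1 = 2` closed orbits of length `1`
  obtain ⟨X, hX, H, hT, hH, hcount⟩ := exists_halvingData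
    (fun n => if n = 0 then 0 else a n - e n - if n = 1 then 1 else 0)
    (fun n => if n = 0 then 0 else e (2 * n)) rfl rfl
  have hcount' : ∀ n, n ≠ 0 → orbitCount H.T n = a n ∧ orbitCount H.halvedMap n = b n := by
    intro n hn
    obtain ⟨h1, h2⟩ := hcount n
    have h3 := hea n hn
    have h4 := hbe n hn
    have h5 : (if Even n then (if n / 2 = 0 then 0 else e (2 * (n / 2))) else 0) = e n := by
      split_ifs with h6 h7
      · obtain ⟨k, rfl⟩ := h6
        omega
      · rw [Nat.mul_div_cancel' h6.two_dvd]
      · exact (heo n h6).symm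
    have h6 : n = 1 → e n = 0 ∧ a n = 2 := by
      rintro rfl
      exact ⟨he1, ha1⟩
    rw [h1, h2, h5, if_neg hn, if_neg hn]
    split_ifs with h7
    · have := h6 h7
      omega
    · omega
  have hpT : ∀ n, n ≠ 0 → periodCount H.T n = 2 ^ n := fun n hn => by
    exact_mod_cast hT.periodCount_eq (fun n hn => (hcount' n hn).1) ha hn
  have hpH : ∀ n, n ≠ 0 → periodCount H.halvedMap n = 2 ^ n + c n * 2 ^ n := fun n hn => by
    have hb' : ∀ n, n ≠ 0 → (n * b n : ℤ) = moebiusTransform (fun d => 2 ^ d + c d * 2 ^ d) n := by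
      intro n hn
      rw [hb n hn, moebiusTransform, moebiusTransform, moebiusTransform, ← Finset.sum_add_distrib]
      exact Finset.sum_congr rfl fun d _ => by ring
    exact_mod_cast hH.periodCount_eq (fun n hn => (hcount' n hn).2) hb' hn
  have hzeta := fun (z : ℂ) (hz : ‖z‖ < 1 / 2) => dynZeta_of_periodCount_eq hc.le_two_mul hpH hz
  have hseries := summable_and_differentiableOn_of_le hc.le_two_mul
  have hnat : HasNaturalBoundary (dynZeta H.halvedMap) (1 / 2) := by
    refine hasNaturalBoundary_of_logDeriv (f := fun u => ∑' n : ℕ, (c n : ℂ) * u ^ n)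
      (fun z hz => (hzeta z (mem_ball_zero_iff.1 hz)).2.2.1.differentiableWithinAt)
      (fun z _ => Complex.exp_ne_zero _) (fun z hz => ?_) (fun w hw ε hε g hg =>
        hc.not_continuation (fun z hz => (hseries.1 z hz).hasSum) hseries.2 hw hε hg)
    rw [(hzeta z (mem_ball_zero_iff.1 hz)).2.2.2]
    simp only [mul_pow, mul_assoc]
  have hhalf : ((1 / 2 : NNReal) : ENNReal) = 1 / 2 := by
    rw [ENNReal.coe_div two_ne_zero, ENNReal.coe_one, ENNReal.coe_ofNat]
  refine ⟨X, hX, H, hT, hH, fun n hn => hcount' n (by omega),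
    fun z hz => dynZeta_eq_of_periodCount_eq_two_pow hpT hz,
    fun z hz => ⟨(hzeta z hz).1, (hzeta z hz).2.1, (hzeta z hz).2.2.2⟩, ?_, hnat⟩
  rw [← hhalf]
  exact HasNaturalBoundary.exists_hasFPowerSeriesOnBall (by simpa using hnat)
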